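/- Let $k$ be a field in which $2$ and $3$ are invertible and let $i\in k$ satisfy $i^2=-1$. Let $B=k[t^2,t^3]\subset k[t]$ and $$T=\begin{pmatrix} t & t-i & -\tfrac13 t^{-1}-\tfrac12 t\\ 0&-t&t+i\\ 0&0&t\end{pmatrix}\in M_3(k(t)).$$ For $f\in B$ the matrix $f(T)$ lies in $M_3(B)\subset M_3(k(t))$, so $\sigma(f)=f(T)$ defines an algebra morphism $\sigma\colon B\to M_3(B)$; regard it as a matrix $\sigma=(\sigma_{ij})\in M_3(\mathrm{End}_k(B))$. There is a unique family $\sigma_d\in M_3(\mathrm{End}_k(B))$, $d\in\mathbb Z$, with $\sigma_0=\sigma$ and $\sigma_d\,\sigma_{d+1}^T=\sigma_{d+1}^T\,\sigma_d=1$ for all $d$. Let $A$ be the Hopf algebra generated by $s_{d,ij}$ ($d\in\mathbb Z$, $1\le i,j\le 3$) subject to $\sum_r s_{d,ir}s_{d+1,jr}=\delta_{ij}=\sum_r s_{d+1,ri}s_{d,rj}$, with $\Delta(s_{d,ij})=\sum_r s_{d,ir}\otimes s_{d,rj}$, $\varepsilon(s_{d,ij})=\delta_{ij}$, $S(s_{d,ij})=s_{d+1,ji}$.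 It acts on $B$ through the algebra morphism $A\to\mathrm{End}_k(B)$, $s_{d,ij}\mapsto\sigma_{d,ij}$. Let $J_\sigma$ be the sum of all Hopf ideals of $A$ contained in the kernel of this morphism, and let $H_\sigma=A/J_\sigma$ be the resulting Hopf algebra (the Hopf image of the action). In $H_\sigma$ put $K=[s_{0,22}]$, $E=[s_{0,12}]$, $Z=[s_{0,13}]$ and $$D=\tfrac{i}{2}(E-KEK),\qquad Y=3\,(Z+KZK)-\tfrac32\,(K-1).$$ Let $\tilde H_\sigma$ be the algebra generated by $\tilde K,\tilde D,\tilde Y$ subject to $$\tilde K^2=1,\quad \tilde K\tilde D+\tilde D\tilde K=0,\quad \tilde K\tilde Y=\tilde Y\tilde K,\quad \tilde Y^2\tilde D-2\tilde Y\tilde D\tilde Y+\tilde D\tilde Y^2=0,\quad \tilde D^2=0.$$ It is a Hopf algebra with $$\Delta(\tilde K)=\tilde K\otimes\tilde K,\quad \Delta(\tilde D)=1\otimes\tilde D+\tilde D\otimes\tilde K,\quad \Delta(\tilde Y)=1\otimes\tilde Y-6\,\tilde D\otimes\tilde D\tilde K+\tilde Y\otimes 1,$$ $\varepsilon(\tilde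 K)=1$, $\varepsilon(\tilde D)=\varepsilon(\tilde Y)=0$, $S(\tilde K)=\tilde K$, $S(\tilde D)=-\tilde D\tilde K$, $S(\tilde Y)=-\tilde Y$. **Proposition.** There is a surjective morphism of Hopf algebras $\varphi\colon\tilde H_\sigma\to H_\sigma$ with $\tilde K\mapsto K$, $\tilde D\mapsto D$, $\tilde Y\mapsto Y$; in particular $$\Delta(K)=K\otimes K,\quad \Delta(D)=1\otimes D+D\otimes K,\quad \Delta(Y)=1\otimes Y-6\,D\otimes DK+Y\otimes 1$$ in $H_\sigma$. If $k$ has characteristic $0$, then $\varphi$ is an isomorphism. -/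

import Mathlib

open scoped TensorProduct Polynomial Matrix

noncomputable section

section HopfOfGenerators

variable {k A : Type*} [CommRing k] [Ring A] [Bialgebra k A]

/-- The linear map underlying an algebra morphism to the opposite algebra. -/
def antiLinear (S : A →ₐ[k] Aᵐᵒᵖ) : A →ₗ[k] A :=
  (MulOpposite.opLinearEquiv k).symm.toLinearMap ∘ₗ S.toLinearMap

theorem antiLinear_mul (S : A →ₐ[k] Aᵐᵒᵖ) (a b : A) :
    antiLinear S (a * b) = antiLinear S b * antiLinear S a := by
  simp [antiLinear]

theorem antiLinear_one (S : A →ₐ[k] Aᵐᵒᵖ) : antiLinear S 1 = 1 := by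
  simp [antiLinear]

theorem antiLinear_rTensor_mul (S : A →ₐ[k] Aᵐᵒᵖ) (u v : A ⊗[k] A) (r : k)
    (hu : LinearMap.mul' k A ((antiLinear S).rTensor A u) = algebraMap k A r) :
    LinearMap.mul' k A ((antiLinear S).rTensor A (u * v)) =
      r • LinearMap.mul' k A ((antiLinear S).rTensor A v) := by
  induction v using TensorProduct.induction_on with
  | zero => simp
  | add x y hx hy => simp only [mul_add, map_add, hx, hy, smul_add]
  | tmul c d =>
    have key : ∀ w : A ⊗[k] A,
        LinearMap.mul' k A ((antiLinear S).rTensor A (w * c ⊗ₜ[k] d)) =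
          antiLinear S c * LinearMap.mul' k A ((antiLinear S).rTensor A w) * d := by
      intro w
      induction w using TensorProduct.induction_on with
      | zero => simp
      | add x y hx hy => simp only [add_mul, mul_add, map_add, hx, hy]
      | tmul a b => simp [antiLinear_mul, mul_assoc]
    rw [key, hu, ← Algebra.commutes, mul_assoc, Algebra.smul_def]
    simp

theorem antiLinear_lTensor_mul (S : A →ₐ[k] Aᵐᵒᵖ) (u v : A ⊗[k] A) (r : k)
    (hv : LinearMap.mul' k A ((antiLinear S).lTensor A v) = algebraMap k A r) :
    LinearMap.mul' k A ((antiLinear S).lTensor A (u * v)) =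
      r • LinearMap.mul' k A ((antiLinear S).lTensor A u) := by
  induction u using TensorProduct.induction_on with
  | zero => simp
  | add x y hx hy => simp only [add_mul, map_add, hx, hy, smul_add]
  | tmul c d =>
    have key : ∀ w : A ⊗[k] A,
        LinearMap.mul' k A ((antiLinear S).lTensor A (c ⊗ₜ[k] d * w)) =
          c * LinearMap.mul' k A ((antiLinear S).lTensor A w) * antiLinear S d := by
      intro w
      induction w using TensorProduct.induction_on with
      | zero => simp
      | add x y hx hy => simp only [add_mul, mul_add, map_add, hx, hy]
      | tmul a b => simp [antiLinear_mul, mul_assoc]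
    rw [key, hv, ← Algebra.commutes, mul_assoc, Algebra.smul_def]
    simp

/-- A bialgebra with an anti-endomorphism that satisfies the antipode axioms on a set of
algebra generators is a Hopf algebra. -/
abbrev hopfOfGenerators (S : A →ₐ[k] Aᵐᵒᵖ) (s : Set A) (hs : Algebra.adjoin k s = ⊤)
    (hl : ∀ a ∈ s, LinearMap.mul' k A ((antiLinear S).rTensor A (Coalgebra.comul a)) =
      algebraMap k A (Coalgebra.counit a))
    (hr : ∀ a ∈ s, LinearMap.mul' k A ((antiLinear S).lTensor A (Coalgebra.comul a)) =
      algebraMap k A (Coalgebra.counit a)) : HopfAlgebra k A where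
  antipode := antiLinear S
  mul_antipode_rTensor_comul := by
    ext a
    have ha : a ∈ Algebra.adjoin k s := hs ▸ Algebra.mem_top
    show LinearMap.mul' k A ((antiLinear S).rTensor A (Coalgebra.comul a)) =
      algebraMap k A (Coalgebra.counit a)
    induction ha using Algebra.adjoin_induction with
    | mem x hx => exact hl x hx
    | algebraMap r =>
      simp [Algebra.algebraMap_eq_smul_one, Algebra.TensorProduct.one_def, antiLinear_one]
    | add x y _ _ hx hy => simp only [map_add, hx, hy]
    | mul x y _ _ hx hy =>
      rw [Bialgebra.comul_mul, antiLinear_rTensor_mul S _ _ _ hx, hy, Bialgebra.counit_mul,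
        map_mul, Algebra.smul_def]
  mul_antipode_lTensor_comul := by
    ext a
    have ha : a ∈ Algebra.adjoin k s := hs ▸ Algebra.mem_top
    show LinearMap.mul' k A ((antiLinear S).lTensor A (Coalgebra.comul a)) =
      algebraMap k A (Coalgebra.counit a)
    induction ha using Algebra.adjoin_induction with
    | mem x hx => exact hr x hx
    | algebraMap r =>
      simp [Algebra.algebraMap_eq_smul_one, Algebra.TensorProduct.one_def, antiLinear_one]
    | add x y _ _ hx hy => simp only [map_add, hx, hy]
    | mul x y _ _ hx hy =>
      rw [Bialgebra.comul_mul, antiLinear_lTensor_mul S _ _ _ hy, hx, Bialgebra.counit_mul,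
        map_mul, Algebra.smul_def, ← map_mul, mul_comm, map_mul]

end HopfOfGenerators

section Presented

/-- The algebra `k⟨X⟩ / ⟨S⟩` given by generators `X` and relators `S`. -/
def PresAlg (k : Type*) {X : Type*} [CommRing k] (S : Set (FreeAlgebra k X)) : Type _ :=
  FreeAlgebra k X ⧸ (TwoSidedIdeal.span S).asIdeal

namespace PresAlg

variable (k : Type*) {X : Type*} [CommRing k] (S : Set (FreeAlgebra k X))

instance : Ring (PresAlg k S) :=
  inferInstanceAs (Ring (FreeAlgebra k X ⧸ (TwoSidedIdeal.span S).asIdeal))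

instance : Algebra k (PresAlg k S) :=
  inferInstanceAs (Algebra k (FreeAlgebra k X ⧸ (TwoSidedIdeal.span S).asIdeal))

/-- The quotient map. -/
def mk : FreeAlgebra k X →ₐ[k] PresAlg k S := Ideal.Quotient.mkₐ k (TwoSidedIdeal.span S).asIdeal

theorem mk_surjective : Function.Surjective (mk k S) := Ideal.Quotient.mkₐ_surjective k _

theorem mk_eq_zero_iff (a : FreeAlgebra k X) : mk k S a = 0 ↔ a ∈ TwoSidedIdeal.span S :=
  Ideal.Quotient.eq_zero_iff_mem.trans TwoSidedIdeal.mem_asIdeal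

/-- The class of a generator. -/
def of (x : X) : PresAlg k S := mk k S (FreeAlgebra.ι k x)

theorem lift_of_eq_zero {s : FreeAlgebra k X} (hs : s ∈ S) :
    FreeAlgebra.lift k (of k S) s = 0 := by
  have h : FreeAlgebra.lift k (of k S) = mk k S := by
    ext x; simp [of]
  rw [h, mk_eq_zero_iff]
  exact TwoSidedIdeal.subset_span hs

variable {k S}

/-- The algebra morphism determined by a family of elements that satisfies the relations. -/
def lift {A : Type*} [Ring A] [Algebra k A] (f : X → A)
    (h : ∀ s ∈ S, FreeAlgebra.lift k f s = 0) : PresAlg k S →ₐ[k] A :=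
  Ideal.Quotient.liftₐ _ (FreeAlgebra.lift k f) (by
    intro a ha
    have hle : TwoSidedIdeal.span S ≤ TwoSidedIdeal.ker (FreeAlgebra.lift k f) :=
      TwoSidedIdeal.span_le.2 fun s hs => (TwoSidedIdeal.mem_ker _).2 (h s hs)
    exact (TwoSidedIdeal.mem_ker _).1 (hle (TwoSidedIdeal.mem_asIdeal.1 ha)))

@[simp]
theorem lift_of {A : Type*} [Ring A] [Algebra k A] (f : X → A)
    (h : ∀ s ∈ S, FreeAlgebra.lift k f s = 0) (x : X) : lift f h (of k S x) = f x := by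
  have h' : lift f h (of k S x) = FreeAlgebra.lift k f (FreeAlgebra.ι k x) := rfl
  simp [h']

theorem hom_ext {A : Type*} [Semiring A] [Algebra k A] {f g : PresAlg k S →ₐ[k] A}
    (h : ∀ x, f (of k S x) = g (of k S x)) : f = g := by
  have h' : f.comp (mk k S) = g.comp (mk k S) := by
    apply FreeAlgebra.hom_ext
    funext x
    exact h x
  ext x
  obtain ⟨y, rfl⟩ := mk_surjective k S x
  exact AlgHom.congr_fun h' y

variable (k S)

theorem adjoin_of : Algebra.adjoin k (Set.range (of k S)) = ⊤ := by
  have : Set.range (of k S) = mk k S '' Set.range (FreeAlgebra.ι k) := by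
    rw [← Set.range_comp]; rfl
  rw [this, ← AlgHom.map_adjoin, FreeAlgebra.adjoin_range_ι, Algebra.map_top,
    AlgHom.range_eq_top]
  exact mk_surjective k S

end PresAlg

end Presented

section FreeHopf

variable (k n : Type*) [CommRing k] [Fintype n] [DecidableEq n]

/-- The relators `∑ r, s_{d,ir} s_{d+1,jr} - δ_{ij}` and `∑ r, s_{d+1,ri} s_{d,rj} - δ_{ij}`,
where `s_{d,ij} = FreeAlgebra.ι k (d, i, j)`. -/
def freeHopfRel : Set (FreeAlgebra k (ℤ × n × n)) :=
  {z | ∃ (d : ℤ) (i j : n),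
    z = ∑ r, FreeAlgebra.ι k (d, i, r) * FreeAlgebra.ι k (d + 1, j, r) - (if i = j then 1 else 0) ∨
    z = ∑ r, FreeAlgebra.ι k (d + 1, r, i) * FreeAlgebra.ι k (d, r, j) - (if i = j then 1 else 0)}

/-- The algebra `k⟨s_{d,ij}⟩ / I`. -/
abbrev FreeHopf : Type _ := PresAlg k (freeHopfRel k n)

namespace FreeHopf

variable {n}

/-- The class of the generator `s_{d,ij}`. -/
def gen (d : ℤ) (i j : n) : FreeHopf k n := PresAlg.of k (freeHopfRel k n) (d, i, j)

variable {k}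

theorem gen_mul_inv (d : ℤ) (i j : n) :
    ∑ r, gen k d i r * gen k (d + 1) j r = if i = j then 1 else 0 := by
  have := PresAlg.lift_of_eq_zero k (freeHopfRel k n) ⟨d, i, j, Or.inl rfl⟩
  rw [map_sub, map_sum] at this
  simp only [map_mul, FreeAlgebra.lift_ι_apply, apply_ite (FreeAlgebra.lift k _), map_one,
    map_zero] at this
  exact sub_eq_zero.1 this

theorem gen_inv_mul (d : ℤ) (i j : n) :
    ∑ r, gen k (d + 1) r i * gen k d r j = if i = j then 1 else 0 := by
  have := PresAlg.lift_of_eq_zero k (freeHopfRel k n) ⟨d, i, j, Or.inr rfl⟩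
  rw [map_sub, map_sum] at this
  simp only [map_mul, FreeAlgebra.lift_ι_apply, apply_ite (FreeAlgebra.lift k _), map_one,
    map_zero] at this
  exact sub_eq_zero.1 this

/-- The algebra morphism determined by a family of elements that satisfies the relations. -/
def lift {A : Type*} [Ring A] [Algebra k A] (f : ℤ → n → n → A)
    (h₁ : ∀ d i j, ∑ r, f d i r * f (d + 1) j r = if i = j then 1 else 0)
    (h₂ : ∀ d i j, ∑ r, f (d + 1) r i * f d r j = if i = j then 1 else 0) :
    FreeHopf k n →ₐ[k] A :=
  PresAlg.lift (fun x => f x.1 x.2.1 x.2.2) (by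
    rintro _ ⟨d, i, j, rfl | rfl⟩
    · rw [map_sub, map_sum]
      simp only [map_mul, FreeAlgebra.lift_ι_apply, apply_ite (FreeAlgebra.lift k _), map_one,
        map_zero, h₁, sub_self]
    · rw [map_sub, map_sum]
      simp only [map_mul, FreeAlgebra.lift_ι_apply, apply_ite (FreeAlgebra.lift k _), map_one,
        map_zero, h₂, sub_self])

@[simp]
theorem lift_gen {A : Type*} [Ring A] [Algebra k A] (f : ℤ → n → n → A)
    (h₁ : ∀ d i j, ∑ r, f d i r * f (d + 1) j r = if i = j then 1 else 0)
    (h₂ : ∀ d i j, ∑ r, f (d + 1) r i * f d r j = if i = j then 1 else 0)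
    (d : ℤ) (i j : n) : lift f h₁ h₂ (gen k d i j) = f d i j :=
  PresAlg.lift_of _ _ _

theorem hom_ext {A : Type*} [Semiring A] [Algebra k A] {f g : FreeHopf k n →ₐ[k] A}
    (h : ∀ d i j, f (gen k d i j) = g (gen k d i j)) : f = g := by
  apply PresAlg.hom_ext
  intro x
  exact h x.1 x.2.1 x.2.2

variable (k n)

/-- `Δ(s_{d,ij}) = ∑ r, s_{d,ir} ⊗ s_{d,rj}`. -/
def comulHom : FreeHopf k n →ₐ[k] FreeHopf k n ⊗[k] FreeHopf k n :=
  lift (fun d i j => ∑ r, gen k d i r ⊗ₜ[k] gen k d r j)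
    (by
      intro d i j
      simp only [Finset.sum_mul_sum, Algebra.TensorProduct.tmul_mul_tmul]
      rw [Finset.sum_comm]
      have : ∀ a : n, ∑ r, ∑ b, (gen k d i a * gen k (d + 1) j b) ⊗ₜ[k]
          (gen k d a r * gen k (d + 1) b r) = (gen k d i a * gen k (d + 1) j a) ⊗ₜ[k] 1 := by
        intro a
        rw [Finset.sum_comm]
        simp [← TensorProduct.tmul_sum, gen_mul_inv, TensorProduct.tmul_ite]
      simp only [this, ← TensorProduct.sum_tmul, gen_mul_inv]
      split_ifs <;> simp [Algebra.TensorProduct.one_def])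
    (by
      intro d i j
      simp only [Finset.sum_mul_sum, Algebra.TensorProduct.tmul_mul_tmul]
      rw [Finset.sum_comm]
      have : ∀ a : n, ∑ r, ∑ b, (gen k (d + 1) r a * gen k d r b) ⊗ₜ[k]
          (gen k (d + 1) a i * gen k d b j) = 1 ⊗ₜ[k] (gen k (d + 1) a i * gen k d a j) := by
        intro a
        rw [Finset.sum_comm]
        simp [← TensorProduct.sum_tmul, gen_inv_mul, TensorProduct.ite_tmul]
      simp only [this, ← TensorProduct.tmul_sum, gen_inv_mul]
      split_ifs <;> simp [Algebra.TensorProduct.one_def])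

/-- `ε(s_{d,ij}) = δ_{ij}`. -/
def counitHom : FreeHopf k n →ₐ[k] k :=
  lift (fun _ i j => if i = j then 1 else 0)
    (by intro d i j; simp [eq_comm (a := j)])
    (by
      intro d i j
      simp only [ite_mul, one_mul, zero_mul, Finset.sum_ite_eq', Finset.mem_univ, if_true])

/-- `S(s_{d,ij}) = s_{d+1,ji}`, as an algebra morphism to the opposite algebra. -/
def antipodeHom : FreeHopf k n →ₐ[k] (FreeHopf k n)ᵐᵒᵖ :=
  lift (fun d i j => MulOpposite.op (gen k (d + 1) j i))
    (by
      intro d i j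
      apply MulOpposite.unop_injective
      simp only [← MulOpposite.op_mul, Finset.unop_sum, MulOpposite.unop_op]
      rw [gen_inv_mul]
      split_ifs <;> simp_all)
    (by
      intro d i j
      apply MulOpposite.unop_injective
      simp only [← MulOpposite.op_mul, Finset.unop_sum, MulOpposite.unop_op]
      rw [gen_mul_inv]
      split_ifs <;> simp_all)

instance : Bialgebra k (FreeHopf k n) :=
  Bialgebra.ofAlgHom (comulHom k n) (counitHom k n)
    (by
      apply hom_ext
      intro d i j
      simp only [comulHom, AlgHom.comp_apply, lift_gen, map_sum, Algebra.TensorProduct.map_tmul,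
        AlgHom.id_apply, TensorProduct.sum_tmul, TensorProduct.tmul_sum]
      rw [Finset.sum_comm]
      simp)
    (by
      apply hom_ext
      intro d i j
      simp [comulHom, counitHom, TensorProduct.ite_tmul])
    (by
      apply hom_ext
      intro d i j
      simp [comulHom, counitHom, TensorProduct.tmul_ite])

theorem comul_gen (d : ℤ) (i j : n) : Coalgebra.comul (R := k) (gen k d i j) =
    ∑ r, gen k d i r ⊗ₜ[k] gen k d r j := by
  have h : Coalgebra.comul (R := k) (gen k d i j) = comulHom k n (gen k d i j) := rfl
  rw [h, comulHom, lift_gen]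

theorem counit_gen (d : ℤ) (i j : n) :
    Coalgebra.counit (R := k) (gen k d i j) = if i = j then 1 else 0 := by
  have h : Coalgebra.counit (R := k) (gen k d i j) = counitHom k n (gen k d i j) := rfl
  rw [h, counitHom, lift_gen]

theorem antiLinear_gen (d : ℤ) (i j : n) :
    antiLinear (antipodeHom k n) (gen k d i j) = gen k (d + 1) j i := by
  simp [antiLinear, antipodeHom]

instance : HopfAlgebra k (FreeHopf k n) :=
  hopfOfGenerators (antipodeHom k n) _ (PresAlg.adjoin_of k (freeHopfRel k n))
    (by
      rintro _ ⟨⟨d, i, j⟩, rfl⟩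
      change LinearMap.mul' k _ (LinearMap.rTensor _ _ (Coalgebra.comul (gen k d i j))) =
        algebraMap k _ (Coalgebra.counit (gen k d i j))
      rw [comul_gen, counit_gen]
      simp only [map_sum, LinearMap.rTensor_tmul, LinearMap.mul'_apply, antiLinear_gen,
        gen_inv_mul]
      split_ifs <;> simp)
    (by
      rintro _ ⟨⟨d, i, j⟩, rfl⟩
      change LinearMap.mul' k _ (LinearMap.lTensor _ _ (Coalgebra.comul (gen k d i j))) =
        algebraMap k _ (Coalgebra.counit (gen k d i j))
      rw [comul_gen, counit_gen]
      simp only [map_sum, LinearMap.lTensor_tmul, LinearMap.mul'_apply, antiLinear_gen,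
        gen_mul_inv]
      split_ifs <;> simp)

end FreeHopf

end FreeHopf

section HopfImage

variable {k : Type*} [CommRing k]

/-- The sum of all Hopf ideals contained in the kernel of an algebra morphism. -/
def hopfKer {A P : Type*} [Ring A] [HopfAlgebra k A] [Ring P] [Algebra k P] (f : A →ₐ[k] P) :
    Ideal A :=
  sSup {I : Ideal A | I.IsTwoSided ∧ I.IsHopfIdeal k ∧ I ≤ RingHom.ker f}

theorem hopfKer_induction {A P : Type*} [Ring A] [HopfAlgebra k A] [Ring P] [Algebra k P]
    {f : A →ₐ[k] P} {p : A → Prop} {a : A} (ha : a ∈ hopfKer f)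
    (h_mem : ∀ I ∈ {I : Ideal A | I.IsTwoSided ∧ I.IsHopfIdeal k ∧ I ≤ RingHom.ker f},
      ∀ x ∈ I, p x) (h_zero : p 0) (h_add : ∀ x y, p x → p y → p (x + y)) : p a := by
  rw [hopfKer, sSup_eq_iSup'] at ha
  exact Submodule.iSup_induction _ (motive := p) ha (fun I x hx => h_mem I.1 I.2 x hx) h_zero h_add

instance {A P : Type*} [Ring A] [HopfAlgebra k A] [Ring P] [Algebra k P] (f : A →ₐ[k] P) :
    (hopfKer f).IsTwoSided where
  mul_mem_of_left {a} b ha := by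
    refine hopfKer_induction (p := fun x => x * b ∈ hopfKer f) ha ?_ ?_ ?_
    · intro I hI x hx
      have := hI.1
      exact le_sSup (a := I) hI (I.mul_mem_right b hx)
    · simp
    · intro x y hx hy
      simpa [add_mul] using add_mem hx hy

instance {A P : Type*} [Ring A] [HopfAlgebra k A] [Ring P] [Algebra k P] (f : A →ₐ[k] P) :
    (hopfKer f).IsHopfIdeal k where
  counit_eq_zero := by
    intro a ha
    refine hopfKer_induction (p := fun x => Coalgebra.counit (R := k) x = 0) ha ?_ ?_ ?_
    · intro I hI x hx
      have := hI.2.1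
      exact Submodule.IsCoideal.counit_eq_zero (I := I.restrictScalars k) hx
    · simp
    · intro x y hx hy
      simp [hx, hy]
  map_mkQ_comul_eq_zero := by
    intro a ha
    refine hopfKer_induction (p := fun x => TensorProduct.map
      ((hopfKer f).restrictScalars k).mkQ ((hopfKer f).restrictScalars k).mkQ
      (Coalgebra.comul x) = 0) ha ?_ ?_ ?_
    · intro I hI x hx
      have := hI.2.1
      have h0 := Submodule.IsCoideal.map_mkQ_comul_eq_zero (I := I.restrictScalars k) hx
      have hle : I.restrictScalars k ≤ (hopfKer f).restrictScalars k := le_sSup (a := I) hI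
      have e : ((hopfKer f).restrictScalars k).mkQ =
          Submodule.factor hle ∘ₗ (I.restrictScalars k).mkQ := by ext; rfl
      rw [e, TensorProduct.map_comp, LinearMap.comp_apply, h0, map_zero]
    · simp
    · intro x y hx hy
      rw [map_add, map_add, hx, hy, add_zero]
  antipode_mem := by
    intro a ha
    refine hopfKer_induction
      (p := fun x => HopfAlgebra.antipode k x ∈ hopfKer f) ha ?_ ?_ ?_
    · intro I hI x hx
      have := hI.2.1
      exact le_sSup (a := I) hI (Ideal.IsHopfIdeal.antipode_mem (R := k) hx)
    · simp
    · intro x y hx hy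
      simpa using add_mem hx hy

variable (k) in
/-- A quantum automorphism `σ` of a `k`-algebra `B`: the strongly invertible matrix
`σ = seq 0` over `End_k(B)`, together with the family `σ_d`, `d ∈ ℤ`, determined by it through
`σ_{d+1} = (σ_d⁻¹)ᵀ`. -/
structure QuantumAut (B n : Type*) [Ring B] [Algebra k B] [Fintype n] [DecidableEq n] where
  seq : ℤ → Matrix n n (Module.End k B)
  mul_transpose : ∀ d, seq d * (seq (d + 1))ᵀ = 1
  transpose_mul : ∀ d, (seq (d + 1))ᵀ * seq d = 1
  apply_one : ∀ i j, seq 0 i j 1 = if i = j then 1 else 0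
  apply_mul : ∀ i j a b, seq 0 i j (a * b) = ∑ l, seq 0 i l a * seq 0 l j b

namespace QuantumAut

variable {B n : Type*} [Ring B] [Algebra k B] [Fintype n] [DecidableEq n]

/-- The action `k⟨s_{d,ij}⟩ / I → End_k(B)`, `s_{d,ij} ↦ σ_{d,ij}`. -/
def action (σ : QuantumAut k B n) : FreeHopf k n →ₐ[k] Module.End k B :=
  FreeHopf.lift σ.seq
    (by
      intro d i j
      have h := congrFun (congrFun (σ.mul_transpose d) i) j
      rwa [Matrix.mul_apply, Matrix.one_apply] at h)
    (by
      intro d i j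
      have h := congrFun (congrFun (σ.transpose_mul d) i) j
      rwa [Matrix.mul_apply, Matrix.one_apply] at h)

/-- The Hopf algebra `H_σ`: the Hopf image of the action. -/
abbrev HopfImage (σ : QuantumAut k B n) : Type _ := FreeHopf k n ⧸ hopfKer σ.action

/-- The class `[s_{d,ij}]` in `H_σ`. -/
def gen (σ : QuantumAut k B n) (d : ℤ) (i j : n) : σ.HopfImage :=
  Ideal.Quotient.mk _ (FreeHopf.gen k d i j)

end QuantumAut

end HopfImage

section UpperTriangular

variable {P : Type*} [Ring P]

/-- The upper triangular matrix with rows `(1, E, Z)`, `(0, K, F)`, `(0, 0, 1)`. -/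
def upperMat (K : P) (v : P × P × P) : Matrix (Fin 3) (Fin 3) P :=
  !![1, v.1, v.2.2; 0, K, v.2.1; 0, 0, 1]

/-- The transpose of the inverse of `upperMat K v` when `K ^ 2 = 1`. -/
def lowerMat (K : P) (v : P × P × P) : Matrix (Fin 3) (Fin 3) P :=
  !![1, 0, 0; -(v.1 * K), K, 0; v.1 * K * v.2.1 - v.2.2, -(K * v.2.1), 1]

/-- The entries `(E, F, Z)` of the double contragredient of `upperMat K v`. -/
def upperStep (K : P) (hK : K * K = 1) : Equiv.Perm (P × P × P) where
  toFun v := (K * v.1 * K, K * v.2.1 * K, v.2.2 - v.1 * K * v.2.1 + K * v.2.1 * K * v.1 * K)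
  invFun v := (K * v.1 * K, K * v.2.1 * K, v.2.2 + K * v.1 * K * v.2.1 * K - v.2.1 * K * v.1)
  left_inv v := by
    have h : ∀ x, K * (K * x) = x := fun x => by rw [← mul_assoc, hK, one_mul]
    ext <;> (simp [mul_assoc, h, hK]; try abel)
  right_inv v := by
    have h : ∀ x, K * (K * x) = x := fun x => by rw [← mul_assoc, hK, one_mul]
    ext <;> (simp [mul_assoc, h, hK]; try abel)

theorem upper_mul_lower (K : P) (hK : K * K = 1) (v : P × P × P) :
    upperMat K v * (lowerMat K v)ᵀ = 1 := by
  have h : ∀ x, K * (K * x) = x := fun x => by rw [← mul_assoc, hK, one_mul]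
  ext i j
  fin_cases i <;> fin_cases j <;>
    simp [upperMat, lowerMat, Matrix.mul_apply, Fin.sum_univ_three, mul_assoc, h, hK] <;> abel

theorem lower_mul_upper (K : P) (hK : K * K = 1) (v : P × P × P) :
    (lowerMat K v)ᵀ * upperMat K v = 1 := by
  have h : ∀ x, K * (K * x) = x := fun x => by rw [← mul_assoc, hK, one_mul]
  ext i j
  fin_cases i <;> fin_cases j <;>
    simp [upperMat, lowerMat, Matrix.mul_apply, Fin.sum_univ_three, mul_assoc, h, hK] <;> abel

theorem lower_mul_step (K : P) (hK : K * K = 1) (v : P × P × P) :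
    lowerMat K v * (upperMat K (upperStep K hK v))ᵀ = 1 := by
  have h : ∀ x, K * (K * x) = x := fun x => by rw [← mul_assoc, hK, one_mul]
  ext i j
  fin_cases i <;> fin_cases j <;>
    simp [upperMat, lowerMat, upperStep, Matrix.mul_apply, Fin.sum_univ_three, mul_assoc, h,
      hK] <;> abel

theorem step_mul_lower (K : P) (hK : K * K = 1) (v : P × P × P) :
    (upperMat K (upperStep K hK v))ᵀ * lowerMat K v = 1 := by
  have h : ∀ x, K * (K * x) = x := fun x => by rw [← mul_assoc, hK, one_mul]
  ext i j
  fin_cases i <;> fin_cases j <;>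
    simp [upperMat, lowerMat, upperStep, Matrix.mul_apply, Fin.sum_univ_three, mul_assoc, h, hK]

/-- The sequence of iterated contragredients of `upperMat K v`. -/
def upperSeq (K : P) (hK : K * K = 1) (v : P × P × P) (d : ℤ) : Matrix (Fin 3) (Fin 3) P :=
  if d % 2 = 0 then upperMat K ((upperStep K hK ^ (d / 2)) v)
  else lowerMat K ((upperStep K hK ^ (d / 2)) v)

theorem upperSeq_zero (K : P) (hK : K * K = 1) (v : P × P × P) :
    upperSeq K hK v 0 = upperMat K v := by
  simp [upperSeq]

theorem upperSeq_mul (K : P) (hK : K * K = 1) (v : P × P × P) (d : ℤ) :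
    upperSeq K hK v d * (upperSeq K hK v (d + 1))ᵀ = 1 ∧
      (upperSeq K hK v (d + 1))ᵀ * upperSeq K hK v d = 1 := by
  rcases Int.emod_two_eq_zero_or_one d with hd | hd
  · have h1 : ¬ (d + 1) % 2 = 0 := by omega
    have h2 : (d + 1) / 2 = d / 2 := by omega
    simp only [upperSeq, hd, h1, h2, if_true, if_false]
    exact ⟨upper_mul_lower K hK _, lower_mul_upper K hK _⟩
  · have h0 : ¬ d % 2 = 0 := by omega
    have h1 : (d + 1) % 2 = 0 := by omega
    have h2 : (d + 1) / 2 = 1 + d / 2 := by omega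
    simp only [upperSeq, h0, h1, h2, if_true, if_false, zpow_add, zpow_one, Equiv.Perm.mul_apply]
    exact ⟨lower_mul_step K hK _, step_mul_lower K hK _⟩

end UpperTriangular

section Cusp

variable (k : Type*) [Field k]

/-- The coordinate ring `k[t², t³] ⊆ k[t]` of the cusp. -/
abbrev cuspRing : Subalgebra k k[X] :=
  Algebra.adjoin k {Polynomial.X ^ 2, Polynomial.X ^ 3}

variable {k}

/-- The matrix `T = σ(t)` over `k(t)`. -/
def cuspT (i : k) : Matrix (Fin 3) (Fin 3) (RatFunc k) :=
  let t : RatFunc k := RatFunc.X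
  !![t, t - RatFunc.C i, -(1 / 3) * t⁻¹ - (1 / 2) * t;
     0, -t, t + RatFunc.C i;
     0, 0, t]

variable (k) in
/-- The inclusion `M_3(k[t², t³]) → M_3(k(t))`. -/
def cuspIncl : Matrix (Fin 3) (Fin 3) (cuspRing k) →ₐ[k] Matrix (Fin 3) (Fin 3) (RatFunc k) :=
  ((Algebra.ofId k[X] (RatFunc k)).restrictScalars k |>.comp (cuspRing k).val).mapMatrix

theorem cuspIncl_apply (M : Matrix (Fin 3) (Fin 3) (cuspRing k)) (a b : Fin 3) :
    cuspIncl k M a b = algebraMap k[X] (RatFunc k) (M a b : k[X]) := rfl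

theorem cuspIncl_injective : Function.Injective (cuspIncl k) := by
  intro M N h
  ext1 a b
  have := congrFun (congrFun h a) b
  rw [cuspIncl_apply, cuspIncl_apply] at this
  exact Subtype.ext (RatFunc.algebraMap_injective k this)

variable (k) in
/-- `t²` as an element of `k[t², t³]`. -/
def cuspx : cuspRing k := ⟨Polynomial.X ^ 2, Algebra.subset_adjoin (by simp)⟩

variable (k) in
/-- `t³` as an element of `k[t², t³]`. -/
def cuspy : cuspRing k := ⟨Polynomial.X ^ 3, Algebra.subset_adjoin (by simp)⟩


theorem cuspT_pow (h2 : (2 : k) ≠ 0) (h3 : (3 : k) ≠ 0) (i : k) (hi : i * i = -1) :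
    cuspT i ^ 2 = cuspIncl k
      !![cuspx k, 0, algebraMap k _ (1 / 3); 0, cuspx k, 0; 0, 0, cuspx k] ∧
    cuspT i ^ 3 = cuspIncl k
      !![cuspy k, cuspy k - i • cuspx k, -((1 / 2 : k) • cuspy k);
         0, -cuspy k, cuspy k + i • cuspx k; 0, 0, cuspy k] := by
  have hX : (RatFunc.X : RatFunc k) ≠ 0 := RatFunc.X_ne_zero
  have h2' : (2 : RatFunc k) ≠ 0 := by
    rw [← map_ofNat (RatFunc.C : k →+* RatFunc k) 2]; simpa using h2
  have h3' : (3 : RatFunc k) ≠ 0 := by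
    rw [← map_ofNat (RatFunc.C : k →+* RatFunc k) 3]; simpa using h3
  have hC2 : (RatFunc.C (2 : k) : RatFunc k) = 2 := map_ofNat _ 2
  have hC3 : (RatFunc.C (3 : k) : RatFunc k) = 3 := map_ofNat _ 3
  have hi' : (RatFunc.C i : RatFunc k) ^ 2 = -1 := by
    rw [← map_pow, pow_two, hi]; simp
  have hsq : cuspT i ^ 2 = cuspIncl k
      !![cuspx k, 0, algebraMap k _ (1 / 3); 0, cuspx k, 0; 0, 0, cuspx k] := by
    ext a b
    rw [cuspIncl_apply, pow_two]
    fin_cases a <;> fin_cases b <;>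
      simp [cuspT, cuspx, Matrix.mul_apply, Fin.sum_univ_three, pow_two,
        Polynomial.algebraMap_eq, Subalgebra.coe_algebraMap]
    · ring
    · rw [hC3]; field_simp
      ring_nf
      simp only [hi']
      ring
    · ring
  refine ⟨hsq, ?_⟩
  rw [pow_succ, hsq]
  ext a b
  rw [cuspIncl_apply, Matrix.mul_apply]
  simp only [cuspIncl_apply]
  fin_cases a <;> fin_cases b <;>
    simp [cuspT, cuspx, cuspy, Matrix.mul_apply, Fin.sum_univ_three,
      Polynomial.algebraMap_eq, Subalgebra.coe_algebraMap, Polynomial.smul_eq_C_mul]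
  all_goals try simp only [hC2, hC3]
  all_goals try field_simp
  all_goals try ring


theorem aeval_cuspT_mem (h2 : (2 : k) ≠ 0) (h3 : (3 : k) ≠ 0) (i : k) (hi : i * i = -1)
    (b : cuspRing k) : Polynomial.aeval (cuspT i) (b : k[X]) ∈ (cuspIncl k).range := by
  have h : cuspRing k ≤ (cuspIncl k).range.comap (Polynomial.aeval (cuspT i)) := by
    rw [Algebra.adjoin_le_iff]
    rintro _ (rfl | rfl)
    · simpa using ⟨_, (cuspT_pow h2 h3 i hi).1.symm⟩
    · simpa using ⟨_, (cuspT_pow h2 h3 i hi).2.symm⟩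
  exact h b.2

/-- The algebra morphism `σ : k[t², t³] → M_3(k[t², t³])`, `f ↦ f(T)`. -/
def cuspHom (h2 : (2 : k) ≠ 0) (h3 : (3 : k) ≠ 0) (i : k) (hi : i * i = -1) :
    cuspRing k →ₐ[k] Matrix (Fin 3) (Fin 3) (cuspRing k) :=
  (AlgEquiv.ofInjective (cuspIncl k) cuspIncl_injective).symm.toAlgHom.comp
    (((Polynomial.aeval (cuspT i)).comp (cuspRing k).val).codRestrict (cuspIncl k).range
      (aeval_cuspT_mem h2 h3 i hi))

theorem cuspIncl_cuspHom (h2 : (2 : k) ≠ 0) (h3 : (3 : k) ≠ 0) (i : k) (hi : i * i = -1)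
    (b : cuspRing k) :
    cuspIncl k (cuspHom h2 h3 i hi b) = Polynomial.aeval (cuspT i) (b : k[X]) := by
  have := AlgEquiv.apply_symm_apply (AlgEquiv.ofInjective (cuspIncl k) cuspIncl_injective)
    (((Polynomial.aeval (cuspT i)).comp (cuspRing k).val).codRestrict (cuspIncl k).range
      (aeval_cuspT_mem h2 h3 i hi) b)
  exact congrArg Subtype.val this

theorem aeval_cuspT_entries (i : k) (p : k[X]) :
    Polynomial.aeval (cuspT i) p 1 0 = 0 ∧ Polynomial.aeval (cuspT i) p 2 0 = 0 ∧
    Polynomial.aeval (cuspT i) p 2 1 = 0 ∧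
    Polynomial.aeval (cuspT i) p 0 0 = algebraMap k[X] (RatFunc k) p ∧
    Polynomial.aeval (cuspT i) p 1 1 = algebraMap k[X] (RatFunc k) (p.comp (-Polynomial.X)) ∧
    Polynomial.aeval (cuspT i) p 2 2 = algebraMap k[X] (RatFunc k) p := by
  induction p using Polynomial.induction_on with
  | C a =>
    simp [Matrix.algebraMap_matrix_apply]
  | add p q hp hq => simp_all
  | monomial n a h =>
    rw [pow_succ, ← mul_assoc, map_mul, Polynomial.aeval_X]
    simp only [Matrix.mul_apply, Fin.sum_univ_three, h]
    simp [cuspT]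

variable (h2 : (2 : k) ≠ 0) (h3 : (3 : k) ≠ 0) (i : k) (hi : i * i = -1)

/-- The entries `σ_{ab} ∈ End_k(k[t², t³])`. -/
def cuspEntry (a b : Fin 3) : Module.End k (cuspRing k) where
  toFun x := cuspHom h2 h3 i hi x a b
  map_add' x y := by simp
  map_smul' c x := by simp

theorem cuspEntry_apply (a b : Fin 3) (x : cuspRing k) :
    cuspEntry h2 h3 i hi a b x = cuspHom h2 h3 i hi x a b := rfl

theorem algebraMap_cuspEntry (a b : Fin 3) (x : cuspRing k) :
    algebraMap k[X] (RatFunc k) (cuspEntry h2 h3 i hi a b x : k[X]) =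
      Polynomial.aeval (cuspT i) (x : k[X]) a b := by
  rw [← cuspIncl_cuspHom h2 h3 i hi, cuspIncl_apply]; rfl

theorem cuspEntry_lower :
    cuspEntry h2 h3 i hi 1 0 = 0 ∧ cuspEntry h2 h3 i hi 2 0 = 0 ∧
    cuspEntry h2 h3 i hi 2 1 = 0 ∧ cuspEntry h2 h3 i hi 0 0 = 1 ∧
    cuspEntry h2 h3 i hi 2 2 = 1 := by
  refine ⟨?_, ?_, ?_, ?_, ?_⟩ <;>
  · ext x : 2
    apply RatFunc.algebraMap_injective k
    rw [algebraMap_cuspEntry]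
    obtain ⟨e1, e2, e3, e4, -, e6⟩ := aeval_cuspT_entries i (x : k[X])
    first
    | simpa using e1
    | simpa using e2
    | simpa using e3
    | simpa using e4
    | simpa using e6

theorem cuspEntry_mid (x : cuspRing k) :
    (cuspEntry h2 h3 i hi 1 1 x : k[X]) = (x : k[X]).comp (-Polynomial.X) := by
  apply RatFunc.algebraMap_injective k
  rw [algebraMap_cuspEntry]
  exact (aeval_cuspT_entries i (x : k[X])).2.2.2.2.1

theorem cuspEntry_mid_sq : cuspEntry h2 h3 i hi 1 1 * cuspEntry h2 h3 i hi 1 1 = 1 := by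
  ext x : 2
  simp [cuspEntry_mid, Polynomial.comp_assoc]

theorem upperMat_cusp :
    upperMat (cuspEntry h2 h3 i hi 1 1) (cuspEntry h2 h3 i hi 0 1, cuspEntry h2 h3 i hi 1 2,
      cuspEntry h2 h3 i hi 0 2) = Matrix.of (cuspEntry h2 h3 i hi) := by
  obtain ⟨e1, e2, e3, e4, e5⟩ := cuspEntry_lower h2 h3 i hi
  ext1 a b
  fin_cases a <;> fin_cases b <;> simp [upperMat, e1, e2, e3, e4, e5]

/-- The quantum automorphism `σ` of `k[t², t³]` with `σ(t) = T`; its `0`-th matrix is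
`(cuspEntry a b)`, see `cuspAut_seq_zero`. -/
def cuspAut : QuantumAut k (cuspRing k) (Fin 3) where
  seq := upperSeq (cuspEntry h2 h3 i hi 1 1) (cuspEntry_mid_sq h2 h3 i hi)
    (cuspEntry h2 h3 i hi 0 1, cuspEntry h2 h3 i hi 1 2, cuspEntry h2 h3 i hi 0 2)
  mul_transpose d := (upperSeq_mul _ _ _ d).1
  transpose_mul d := (upperSeq_mul _ _ _ d).2
  apply_one a b := by
    rw [upperSeq_zero, upperMat_cusp]
    simp only [Matrix.of_apply, cuspEntry_apply, map_one, Matrix.one_apply]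
  apply_mul a b x y := by
    rw [upperSeq_zero, upperMat_cusp]
    simp only [Matrix.of_apply, cuspEntry_apply, map_mul, Matrix.mul_apply]

theorem cuspAut_seq_zero (a b : Fin 3) (x : cuspRing k) :
    (cuspAut h2 h3 i hi).seq 0 a b x = cuspHom h2 h3 i hi x a b := by
  have h : (cuspAut h2 h3 i hi).seq 0 = Matrix.of (cuspEntry h2 h3 i hi) :=
    (upperSeq_zero _ _ _).trans (upperMat_cusp h2 h3 i hi)
  rw [h]
  rfl

namespace CuspHopfImage

/-- The element `K = [s_{0,22}]` of `H_σ` (indices start at `0` in `Fin 3`). -/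
def K : (cuspAut h2 h3 i hi).HopfImage := (cuspAut h2 h3 i hi).gen 0 1 1

/-- The element `E = [s_{0,12}]` of `H_σ`. -/
def E : (cuspAut h2 h3 i hi).HopfImage := (cuspAut h2 h3 i hi).gen 0 0 1

/-- The element `Z = [s_{0,13}]` of `H_σ`. -/
def Z : (cuspAut h2 h3 i hi).HopfImage := (cuspAut h2 h3 i hi).gen 0 0 2

/-- The element `D = i E_-` of `H_σ`, where `E_- = (E - K E K) / 2`. -/
def D : (cuspAut h2 h3 i hi).HopfImage :=
  i • ((1 / 2 : k) • (E h2 h3 i hi - K h2 h3 i hi * E h2 h3 i hi * K h2 h3 i hi))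

/-- The element `Y = 6 Z_+ - (3 / 2) (K - 1)` of `H_σ`, where `Z_+ = (Z + K Z K) / 2`. -/
def Y : (cuspAut h2 h3 i hi).HopfImage :=
  (6 : k) • ((1 / 2 : k) • (Z h2 h3 i hi + K h2 h3 i hi * Z h2 h3 i hi * K h2 h3 i hi)) -
    (3 / 2 : k) • (K h2 h3 i hi - 1)

end CuspHopfImage

end Cusp

section CuspHopf

/-- The generators of the presented Hopf algebra. -/
inductive CuspGen
  | K
  | D
  | Y

variable (k : Type*) [CommRing k]

/-- The relators `K² - 1`, `KD + DK`, `KY - YK`, `Y²D - 2YDY + DY²`, `D²`. -/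
def cuspRel : Set (FreeAlgebra k CuspGen) :=
  let K := FreeAlgebra.ι k CuspGen.K
  let D := FreeAlgebra.ι k CuspGen.D
  let Y := FreeAlgebra.ι k CuspGen.Y
  {K ^ 2 - 1, K * D + D * K, K * Y - Y * K,
    Y ^ 2 * D - (2 : k) • (Y * D * Y) + D * Y ^ 2, D ^ 2}

/-- The algebra `k⟨K, D, Y⟩` modulo the ideal generated by `cuspRel`. -/
abbrev CuspHopf : Type _ := PresAlg k (cuspRel k)

namespace CuspHopf

/-- The class of a generator. -/
def gen (x : CuspGen) : CuspHopf k := PresAlg.of k (cuspRel k) x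

variable {k}

/-- The algebra morphism determined by elements that satisfy the relations. -/
def lift {A : Type*} [Ring A] [Algebra k A] (f : CuspGen → A)
    (h₁ : f .K ^ 2 - 1 = 0) (h₂ : f .K * f .D + f .D * f .K = 0)
    (h₃ : f .K * f .Y - f .Y * f .K = 0)
    (h₄ : f .Y ^ 2 * f .D - (2 : k) • (f .Y * f .D * f .Y) + f .D * f .Y ^ 2 = 0)
    (h₅ : f .D ^ 2 = 0) : CuspHopf k →ₐ[k] A :=
  PresAlg.lift f (by
    rintro _ (rfl | rfl | rfl | rfl | rfl)
    · simpa using h₁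
    · simpa using h₂
    · simpa using h₃
    · simpa using h₄
    · simpa using h₅)

@[simp]
theorem lift_gen {A : Type*} [Ring A] [Algebra k A] (f : CuspGen → A) (h₁ h₂ h₃ h₄ h₅)
    (x : CuspGen) : lift (k := k) f h₁ h₂ h₃ h₄ h₅ (gen k x) = f x :=
  PresAlg.lift_of _ _ _

theorem hom_ext {A : Type*} [Semiring A] [Algebra k A] {f g : CuspHopf k →ₐ[k] A}
    (h : ∀ x, f (gen k x) = g (gen k x)) : f = g :=
  PresAlg.hom_ext h

theorem K_sq : gen k .K * gen k .K = 1 := by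
  have := PresAlg.lift_of_eq_zero k (cuspRel k) (Or.inl rfl)
  simp only [map_sub, map_pow, map_one, FreeAlgebra.lift_ι_apply] at this
  rw [← pow_two]
  exact sub_eq_zero.1 this

theorem DK : gen k .D * gen k .K = -(gen k .K * gen k .D) := by
  have := PresAlg.lift_of_eq_zero k (cuspRel k) (Or.inr (Or.inl rfl))
  simp only [map_add, map_mul, FreeAlgebra.lift_ι_apply] at this
  exact eq_neg_of_add_eq_zero_right this

theorem YK : gen k .Y * gen k .K = gen k .K * gen k .Y := by
  have := PresAlg.lift_of_eq_zero k (cuspRel k) (Or.inr (Or.inr (Or.inl rfl)))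
  simp only [map_sub, map_mul, FreeAlgebra.lift_ι_apply] at this
  exact (sub_eq_zero.mp this).symm

theorem YYD : gen k .Y ^ 2 * gen k .D - (2 : k) • (gen k .Y * gen k .D * gen k .Y) +
    gen k .D * gen k .Y ^ 2 = 0 := by
  have := PresAlg.lift_of_eq_zero k (cuspRel k) (Or.inr (Or.inr (Or.inr (Or.inl rfl))))
  simp only [map_sub, map_add, map_smul, map_pow, map_mul, FreeAlgebra.lift_ι_apply] at this
  exact this

theorem D_sq : gen k .D * gen k .D = 0 := by
  have := PresAlg.lift_of_eq_zero k (cuspRel k) (Or.inr (Or.inr (Or.inr (Or.inr rfl))))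
  simp only [map_pow, FreeAlgebra.lift_ι_apply] at this
  rw [← pow_two]
  exact this

/-- The commutator `C = YD - DY`. -/
def C : CuspHopf k := gen k .Y * gen k .D - gen k .D * gen k .Y

theorem YD : gen k .Y * gen k .D = gen k .D * gen k .Y + C := by
  rw [C]; abel

theorem YC : gen k .Y * C = C * gen k .Y := by
  rw [← sub_eq_zero, ← YYD (k := k), C, two_smul]
  noncomm_ring

theorem CK : C * gen k .K = -(gen k .K * C) := by
  rw [C, sub_mul, mul_assoc, DK, mul_assoc, YK, ← mul_assoc, DK, mul_neg, ← mul_assoc, YK]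
  noncomm_ring

theorem CD : C * gen k .D = -(gen k .D * C) := by
  have h : gen k .Y * (gen k .D * gen k .D) = 0 := by rw [D_sq, mul_zero]
  have h' : gen k .D * gen k .D * gen k .Y = 0 := by rw [D_sq, zero_mul]
  rw [← sub_eq_zero, C]
  calc _ = gen k .Y * (gen k .D * gen k .D) - gen k .D * gen k .D * gen k .Y := by noncomm_ring
    _ = 0 := by rw [h, h', sub_zero]

variable (k)

theorem serre_of_commute {R : Type*} [Ring R] {y d c : R} (h₁ : y * d - d * y = c)
    (h₂ : y * c = c * y) : y ^ 2 * d - (y * d * y + y * d * y) + d * y ^ 2 = 0 := by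
  subst h₁
  rw [← sub_eq_zero] at h₂
  rw [← h₂]
  noncomm_ring

/-- The coproduct on generators. -/
def comulGen : CuspGen → CuspHopf k ⊗[k] CuspHopf k
  | .K => gen k .K ⊗ₜ gen k .K
  | .D => 1 ⊗ₜ gen k .D + gen k .D ⊗ₜ gen k .K
  | .Y => 1 ⊗ₜ gen k .Y - (6 : k) • (gen k .D ⊗ₜ (gen k .D * gen k .K)) + gen k .Y ⊗ₜ 1

/-- The counit on generators. -/
def counitGen : CuspGen → k
  | .K => 1
  | .D => 0
  | .Y => 0

/-- The antipode on generators. -/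
def antipodeGen : CuspGen → CuspHopf k
  | .K => gen k .K
  | .D => -(gen k .D * gen k .K)
  | .Y => -gen k .Y

theorem comulGen_comm : comulGen k .Y * comulGen k .D - comulGen k .D * comulGen k .Y =
    1 ⊗ₜ C + C ⊗ₜ gen k .K := by
  have e : gen k .D * gen k .K * gen k .D = 0 := by
    rw [DK, neg_mul, mul_assoc, D_sq, mul_zero, neg_zero]
  have e' : gen k .D * (gen k .D * gen k .K) = 0 := by rw [← mul_assoc, D_sq, zero_mul]
  simp only [comulGen, mul_add, add_mul, mul_sub, sub_mul, mul_smul_comm, smul_mul_assoc,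
    Algebra.TensorProduct.tmul_mul_tmul, one_mul, mul_one, D_sq, e, e', YK, YD,
    TensorProduct.add_tmul, TensorProduct.tmul_add, TensorProduct.zero_tmul,
    TensorProduct.tmul_zero, TensorProduct.sub_tmul, TensorProduct.tmul_sub, smul_zero]
  abel

theorem comulGen_comm_C : comulGen k .Y * (1 ⊗ₜ C + C ⊗ₜ gen k .K) =
    (1 ⊗ₜ C + C ⊗ₜ gen k .K) * comulGen k .Y := by
  have e1 : gen k .D * gen k .K * C = -(gen k .K * (gen k .D * C)) := by
    rw [DK, neg_mul, mul_assoc]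
  have e2 : C * (gen k .D * gen k .K) = -(gen k .K * (gen k .D * C)) := by
    rw [← mul_assoc, CD, neg_mul, mul_assoc, CK, mul_neg, neg_neg, ← mul_assoc, DK, neg_mul,
      mul_assoc]
  have e3 : gen k .D * gen k .K * gen k .K = gen k .D := by rw [mul_assoc, K_sq, mul_one]
  have e4 : gen k .K * (gen k .D * gen k .K) = - gen k .D := by
    rw [DK, mul_neg, ← mul_assoc, K_sq, one_mul]
  simp only [comulGen, mul_add, add_mul, mul_sub, sub_mul, mul_smul_comm, smul_mul_assoc,
    Algebra.TensorProduct.tmul_mul_tmul, one_mul, mul_one, e1, e2, e3, e4, YK, YC, CD,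
    TensorProduct.neg_tmul, TensorProduct.tmul_neg, smul_neg, neg_neg, smul_add]
  abel

/-- The coproduct as an algebra morphism. -/
def comulHom : CuspHopf k →ₐ[k] CuspHopf k ⊗[k] CuspHopf k :=
  lift (comulGen k)
    (by simp only [comulGen, pow_two, Algebra.TensorProduct.tmul_mul_tmul, K_sq,
        Algebra.TensorProduct.one_def, sub_self])
    (by
      simp only [comulGen, mul_add, add_mul, Algebra.TensorProduct.tmul_mul_tmul, one_mul, mul_one,
        DK, TensorProduct.tmul_neg, TensorProduct.neg_tmul]
      abel)
    (by
      have e1 : gen k .K * (gen k .D * gen k .K) = - gen k .D := by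
        rw [DK, mul_neg, ← mul_assoc, K_sq, one_mul]
      have e2 : gen k .D * gen k .K * gen k .K = gen k .D := by rw [mul_assoc, K_sq, mul_one]
      have e3 : gen k .K * gen k .D = -(gen k .D * gen k .K) := by rw [DK, neg_neg]
      simp only [comulGen, mul_add, add_mul, mul_sub, sub_mul, mul_smul_comm, smul_mul_assoc,
        Algebra.TensorProduct.tmul_mul_tmul, one_mul, mul_one, e1, e2, e3,
        YK, TensorProduct.tmul_neg, TensorProduct.neg_tmul, mul_neg, neg_mul, smul_neg]
      abel)
    (by
      rw [two_smul]
      exact serre_of_commute (comulGen_comm k) (comulGen_comm_C k))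
    (by
      simp only [comulGen, pow_two, mul_add, add_mul, Algebra.TensorProduct.tmul_mul_tmul, one_mul,
        mul_one, DK, D_sq, TensorProduct.tmul_neg, TensorProduct.zero_tmul,
        TensorProduct.tmul_zero]
      abel)

/-- The counit as an algebra morphism. -/
def counitHom : CuspHopf k →ₐ[k] k :=
  lift (counitGen k) (by simp [counitGen]) (by simp [counitGen]) (by simp [counitGen])
    (by simp [counitGen]) (by simp [counitGen])

/-- The antipode as an algebra morphism to the opposite algebra. -/
def antipodeHom : CuspHopf k →ₐ[k] (CuspHopf k)ᵐᵒᵖ :=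
  lift (fun x => MulOpposite.op (antipodeGen k x))
    (by
      apply MulOpposite.unop_injective
      simp [antipodeGen, pow_two, K_sq])
    (by
      apply MulOpposite.unop_injective
      simp only [antipodeGen, MulOpposite.unop_add, MulOpposite.unop_mul, MulOpposite.unop_op,
        MulOpposite.unop_zero, neg_mul, mul_neg]
      rw [mul_assoc, K_sq, DK, mul_neg, ← mul_assoc, K_sq]
      simp)
    (by
      apply MulOpposite.unop_injective
      simp [antipodeGen, YK])
    (by
      apply MulOpposite.unop_injective
      simp only [antipodeGen, MulOpposite.unop_add, MulOpposite.unop_sub, MulOpposite.unop_mul,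
        MulOpposite.unop_op, MulOpposite.unop_pow, MulOpposite.unop_smul, MulOpposite.unop_zero]
      have h := congrArg (fun z => -(z * gen k .K)) (YYD (k := k))
      simp only [zero_mul, neg_zero] at h
      rw [← h, two_smul, two_smul]
      have c : gen k .K * gen k .Y = gen k .Y * gen k .K := YK.symm
      have c' : ∀ z, gen k .K * (gen k .Y * z) = gen k .Y * (gen k .K * z) := fun z => by
        rw [← mul_assoc, c, mul_assoc]
      have t : ∀ z : CuspHopf k, z * 2 = z + z := fun z => by noncomm_ring
      have t' : ∀ z : CuspHopf k, 2 * z = z + z := fun z => by noncomm_ring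
      simp only [pow_two, t, t', sub_mul, add_mul, neg_mul, mul_neg, mul_assoc, c, c']
      abel)
    (by
      apply MulOpposite.unop_injective
      simp only [antipodeGen, MulOpposite.unop_pow, MulOpposite.unop_op, MulOpposite.unop_zero,
        MulOpposite.unop_mul, pow_two, neg_mul, mul_neg, neg_neg]
      rw [DK, neg_mul, mul_neg, neg_neg, ← mul_assoc, mul_assoc _ (gen k .D), DK, mul_neg,
        ← mul_assoc, K_sq, one_mul, neg_mul, D_sq, neg_zero])

instance : Bialgebra k (CuspHopf k) :=
  Bialgebra.ofAlgHom (comulHom k) (counitHom k)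
    (by
      apply hom_ext
      have hK : comulHom k (gen k .K) = comulGen k .K := lift_gen ..
      have hD : comulHom k (gen k .D) = comulGen k .D := lift_gen ..
      have hY : comulHom k (gen k .Y) = comulGen k .Y := lift_gen ..
      rintro (_ | _ | _)
      · simp [hK, comulGen]
      · simp [hK, hD, comulGen, Algebra.TensorProduct.one_def, TensorProduct.add_tmul,
          TensorProduct.tmul_add, add_assoc]
      · simp only [AlgHom.comp_apply, hY, comulGen, map_add, map_sub, map_smul,
          Algebra.TensorProduct.map_tmul, AlgHom.id_apply, map_mul, map_one, hD, hK,
          Algebra.TensorProduct.one_def, TensorProduct.add_tmul, TensorProduct.sub_tmul,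
          TensorProduct.tmul_add, TensorProduct.tmul_sub, add_mul,
          Algebra.TensorProduct.tmul_mul_tmul, one_mul, K_sq, ← TensorProduct.smul_tmul',
          TensorProduct.tmul_smul, smul_add, mul_one, Algebra.TensorProduct.assoc_tmul,
          AlgEquiv.toAlgHom_apply]
        abel)
    (by
      apply hom_ext
      have hK : comulHom k (gen k .K) = comulGen k .K := lift_gen ..
      have hD : comulHom k (gen k .D) = comulGen k .D := lift_gen ..
      have hY : comulHom k (gen k .Y) = comulGen k .Y := lift_gen ..
      have hx : ∀ x, counitHom k (gen k x) = counitGen k x := fun x => lift_gen ..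
      rintro (_ | _ | _)
      · simp [hK, comulGen, hx, counitGen]
      · simp [hD, comulGen, hx, counitGen]
      · simp [hY, comulGen, hx, counitGen])
    (by
      apply hom_ext
      have hK : comulHom k (gen k .K) = comulGen k .K := lift_gen ..
      have hD : comulHom k (gen k .D) = comulGen k .D := lift_gen ..
      have hY : comulHom k (gen k .Y) = comulGen k .Y := lift_gen ..
      have hx : ∀ x, counitHom k (gen k x) = counitGen k x := fun x => lift_gen ..
      rintro (_ | _ | _)
      · simp [hK, comulGen, hx, counitGen]
      · simp [hD, comulGen, hx, counitGen]
      · simp [hY, comulGen, hx, counitGen])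

theorem comul_gen (x : CuspGen) : Coalgebra.comul (R := k) (gen k x) = comulGen k x := by
  have h : Coalgebra.comul (R := k) (gen k x) = comulHom k (gen k x) := rfl
  rw [h, comulHom, lift_gen]

theorem counit_gen (x : CuspGen) : Coalgebra.counit (R := k) (gen k x) = counitGen k x := by
  have h : Coalgebra.counit (R := k) (gen k x) = counitHom k (gen k x) := rfl
  rw [h, counitHom, lift_gen]

theorem antiLinear_gen (x : CuspGen) :
    antiLinear (antipodeHom k) (gen k x) = antipodeGen k x := by
  simp [antiLinear, antipodeHom]

instance : HopfAlgebra k (CuspHopf k) :=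
  hopfOfGenerators (antipodeHom k) _ (PresAlg.adjoin_of k (cuspRel k))
    (by
      rintro _ ⟨x, rfl⟩
      change LinearMap.mul' k _ (LinearMap.rTensor _ _ (Coalgebra.comul (gen k x))) =
        algebraMap k _ (Coalgebra.counit (gen k x))
      rw [comul_gen, counit_gen]
      have h : gen k .D * gen k .K * (gen k .D * gen k .K) = 0 := by
        rw [DK, neg_mul_neg, mul_assoc, ← mul_assoc (gen k .D), DK, neg_mul, mul_assoc, D_sq]
        simp
      rcases x with _ | _ | _
      · simp [comulGen, counitGen, antiLinear_gen, antipodeGen, K_sq]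
      · simp [comulGen, counitGen, antiLinear_gen, antipodeGen, antiLinear_one, mul_assoc, K_sq]
      · simp [comulGen, counitGen, antiLinear_gen, antipodeGen, antiLinear_one, h])
    (by
      rintro _ ⟨x, rfl⟩
      change LinearMap.mul' k _ (LinearMap.lTensor _ _ (Coalgebra.comul (gen k x))) =
        algebraMap k _ (Coalgebra.counit (gen k x))
      rw [comul_gen, counit_gen]
      have h : antiLinear (antipodeHom k) (gen k .D * gen k .K) = gen k .D := by
        rw [antiLinear_mul, antiLinear_gen, antiLinear_gen]
        simp only [antipodeGen]
        rw [DK, neg_neg, ← mul_assoc, K_sq, one_mul]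
      rcases x with _ | _ | _
      · simp [comulGen, counitGen, antiLinear_gen, antipodeGen, K_sq]
      · simp [comulGen, counitGen, antiLinear_gen, antipodeGen]
      · simp [comulGen, counitGen, antiLinear_gen, antipodeGen, antiLinear_one, h, D_sq])

end CuspHopf

end CuspHopf

end

/-!
Write `H̃` for the presented Hopf algebra `CuspHopf k`, `A` for `FreeHopf k (Fin 3)`, and `B` for
the ring of the cusp, with basis `x ^ n`, `y * x ^ n`, where `x = t²` and `y = t³`.

*The morphism.* The matrices over the generators of `A` are successive transposed inverses of each
other, so an algebra morphism out of `A` is determined by the matrix in degree `0`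
(`FreeHopf.hom_ext_zero`). In `H̃` the upper triangular matrix with the entries
`CuspHopf.coaction` is a corepresentation, and its iterated contragredients define a surjective
morphism of Hopf algebras `π : A → H̃` (`CuspHopf.ofFreeHopf`). On the other hand `H̃` acts on `B`
(`cuspRep`): `K` is the parity operator, `D` sends `x ^ n` to `0` and `y * x ^ n` to `x ^ (n + 1)`,
and `Y` is `2 d/dx`, with `y` treated as a constant. Comparing the two sides in degree `0` shows
that the action of `A` is the composition of `π` with this action. Hence `ker π` is a Hopf ideal
in the kernel of the action of `A`, and the Hopf image is a quotient `φ : H̃ → H_σ`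
(`QuantumAut.exists_bialgHom_hopfImage`).

*Injectivity in characteristic zero.* The elements of `ker φ` act by zero on `B`, hence also on the
submodule with basis `1`, `x`, `y`. Let `r` be the corresponding matrix representation. As `ker φ`
is a coideal on which `r` vanishes, it is stable under `z ↦ r(z₁)ₐᵦ z₂` for all `a` and `b`
(`map_comulMatrix_eq_zero`). These operators include the automorphism `K ↦ -K`, twice the
derivation `d/dY`, and skew derivations that lower `D` and `C = Y D - D Y`. Since the elements
`K^a D^b C^c Y^n` with `a, b, c ≤ 1` span `H̃` (`CuspHopf.normalForms_eq_top`), a nonzero element of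
`ker φ` can be split by means of the automorphism, multiplied by `D` and `C` to the form
`D C p(Y)` with `p ≠ 0`, and then differentiated until `p` is a nonzero constant, which is where
characteristic zero enters. So `D C` lies in `ker φ`, and lowering gives `D` and then `1`, which
is absurd as `1` acts as the identity (`CuspHopf.injective_of_comulMatrix`). In particular no
linear independence of the spanning elements has to be known in advance.
-/

noncomputable section

/-! ### Hopf ideals and Hopf images -/

section HopfGeneral

/-- The matrices over the generators determine each other recursively: the matrix in degree
`d ± 1` is the transposed inverse of the one in degree `d`. So degree `0` suffices. -/
theorem FreeHopf.hom_ext_zero {k n P : Type*} [CommRing k] [Fintype n] [DecidableEq n] [Ring P]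
    [Algebra k P] {f g : FreeHopf k n →ₐ[k] P}
    (h : ∀ i j, f (FreeHopf.gen k 0 i j) = g (FreeHopf.gen k 0 i j)) : f = g := by
  let M (f : FreeHopf k n →ₐ[k] P) (d : ℤ) : Matrix n n P :=
    Matrix.of fun i j => f (FreeHopf.gen k d i j)
  have h₁ (f : FreeHopf k n →ₐ[k] P) (d : ℤ) : M f d * (M f (d + 1))ᵀ = 1 := by
    ext i j
    simp only [M, Matrix.mul_apply, Matrix.transpose_apply, Matrix.of_apply, ← map_mul,
      ← map_sum, FreeHopf.gen_mul_inv, Matrix.one_apply]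
    split_ifs <;> simp
  have h₂ (f : FreeHopf k n →ₐ[k] P) (d : ℤ) : (M f (d + 1))ᵀ * M f d = 1 := by
    ext i j
    simp only [M, Matrix.mul_apply, Matrix.transpose_apply, Matrix.of_apply, ← map_mul,
      ← map_sum, FreeHopf.gen_inv_mul, Matrix.one_apply]
    split_ifs <;> simp
  have key : ∀ d : ℤ, M f d = M g d := by
    intro d
    induction d using Int.induction_on with
    | zero => ext i j; exact h i j
    | succ d hd =>
      apply Matrix.transpose_injective
      refine left_inv_eq_right_inv (h₂ f d) ?_
      rw [hd]
      exact h₁ g d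
    | pred d hd =>
      have e : (-(d : ℤ) - 1) + 1 = -d := by ring
      have a := h₁ f (-(d : ℤ) - 1)
      have b := h₂ g (-(d : ℤ) - 1)
      rw [e] at a b
      rw [hd] at a
      exact left_inv_eq_right_inv a b
  apply FreeHopf.hom_ext
  intro d i j
  exact congrFun (congrFun (key d) i) j

variable {k A H Q : Type*} [CommRing k]

theorem exists_algHom_of_ker_le [Ring A] [Algebra k A] [Ring H] [Algebra k H] [Ring Q]
    [Algebra k Q] (π : A →ₐ[k] H) (hπ : Function.Surjective π) (q : A →ₐ[k] Q)
    (h : ∀ a, π a = 0 → q a = 0) : ∃ f : H →ₐ[k] Q, ∀ a, f (π a) = q a := by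
  refine ⟨(Ideal.Quotient.liftₐ (RingHom.ker π) q h).comp
    (Ideal.quotientKerAlgEquivOfSurjective hπ).symm.toAlgHom, fun a => ?_⟩
  have e : (Ideal.quotientKerAlgEquivOfSurjective hπ).symm (π a) =
      Ideal.Quotient.mk (RingHom.ker π) a := by
    rw [AlgEquiv.symm_apply_eq]
    rfl
  change Ideal.Quotient.liftₐ (RingHom.ker π) q h
    ((Ideal.quotientKerAlgEquivOfSurjective hπ).symm (π a)) = q a
  rw [e]
  rfl

variable [Ring A] [HopfAlgebra k A]

theorem ker_isHopfIdeal [Ring H] [HopfAlgebra k H] (π : A →ₐc[k] H)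
    (hπ : Function.Surjective π)
    (hS : ∀ a, HopfAlgebra.antipode k (π a) = π (HopfAlgebra.antipode k a)) :
    (RingHom.ker π).IsHopfIdeal k where
  counit_eq_zero x hx := by
    have hx : π x = 0 := hx
    rw [← CoalgHomClass.counit_comp_apply π, hx, map_zero]
  map_mkQ_comul_eq_zero x hx := by
    have hx : π x = 0 := hx
    obtain ⟨f, hf⟩ := exists_algHom_of_ker_le (π : A →ₐ[k] H) hπ
      (Ideal.Quotient.mkₐ k (RingHom.ker π)) fun a ha => Ideal.Quotient.eq_zero_iff_mem.2 ha
    have h : (Ideal.Quotient.mkₐ k (RingHom.ker π)).toLinearMap =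
        f.toLinearMap ∘ₗ (π : A →ₗ[k] H) := by
      ext a
      exact (hf a).symm
    have h0 := CoalgHomClass.map_comp_comul_apply π x
    rw [hx, map_zero] at h0
    change TensorProduct.map (Ideal.Quotient.mkₐ k (RingHom.ker π)).toLinearMap
      (Ideal.Quotient.mkₐ k (RingHom.ker π)).toLinearMap (Coalgebra.comul x) = 0
    rw [h, TensorProduct.map_comp, LinearMap.comp_apply]
    exact (congrArg _ h0).trans (map_zero _)
  antipode_mem x hx := by
    have hx : π x = 0 := hx
    change π _ = 0
    rw [← hS, hx, map_zero]

theorem hopfKer_le_ker {P : Type*} [Ring P] [Algebra k P] (f : A →ₐ[k] P) :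
    hopfKer f ≤ RingHom.ker f :=
  sSup_le fun _ hI => hI.2.2

/-- If a bialgebra morphism `q` vanishes on the kernel of a surjective bialgebra morphism `π`, then
it factors through `π`, and the induced algebra morphism respects the coproduct and the counit. -/
theorem exists_bialgHom_of_ker_le [Ring H] [Bialgebra k H] [Ring Q] [Bialgebra k Q]
    (π : A →ₐc[k] H) (hπ : Function.Surjective π) (q : A →ₐc[k] Q)
    (h : ∀ a, π a = 0 → q a = 0) : ∃ φ : H →ₐc[k] Q, ∀ a, φ (π a) = q a := by
  obtain ⟨f, hf⟩ := exists_algHom_of_ker_le (π : A →ₐ[k] H) hπ (q : A →ₐ[k] Q) h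
  replace hf : ∀ a, f (π a) = q a := hf
  have hf' : f.toLinearMap ∘ₗ (π : A →ₗ[k] H) = (q : A →ₗ[k] Q) := by
    ext a; exact hf a
  refine ⟨BialgHom.ofAlgHom f ?_ ?_, hf⟩
  · ext x
    obtain ⟨a, rfl⟩ := hπ x
    change Coalgebra.counit (f (π a)) = Coalgebra.counit (R := k) (π a)
    rw [hf, CoalgHomClass.counit_comp_apply, CoalgHomClass.counit_comp_apply]
  · ext x
    obtain ⟨a, rfl⟩ := hπ x
    change TensorProduct.map f.toLinearMap f.toLinearMap (Coalgebra.comul (π a)) =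
      Coalgebra.comul (f (π a))
    rw [hf, ← CoalgHomClass.map_comp_comul_apply, ← CoalgHomClass.map_comp_comul_apply,
      ← hf', TensorProduct.map_comp]
    rfl

end HopfGeneral

/-- If the action of the free Hopf algebra on `B` factors through a Hopf algebra quotient `H`,
then the Hopf image is a quotient of `H`, and the action of `H` factors through it. -/
theorem QuantumAut.exists_bialgHom_hopfImage {k B n H : Type*} [CommRing k] [Ring B] [Algebra k B]
    [Fintype n] [DecidableEq n] [Ring H] [HopfAlgebra k H] (σ : QuantumAut k B n)
    (π : FreeHopf k n →ₐc[k] H) (hπ : Function.Surjective π)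
    (hS : ∀ a, HopfAlgebra.antipode k (π a) = π (HopfAlgebra.antipode k a))
    (ρ : H →ₐ[k] Module.End k B) (hρ : ∀ a, ρ (π a) = σ.action a) :
    ∃ φ : H →ₐc[k] σ.HopfImage, (∀ a, φ (π a) = Ideal.Quotient.mk _ a) ∧
      Function.Surjective φ ∧ ∀ x, φ x = 0 → ρ x = 0 := by
  have hker : RingHom.ker π ≤ hopfKer σ.action := by
    refine le_sSup ⟨inferInstance, ker_isHopfIdeal π hπ hS, fun a ha => ?_⟩
    have ha : π a = 0 := ha
    change σ.action a = 0
    rw [← hρ, ha, map_zero]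
  obtain ⟨φ, hφ⟩ := exists_bialgHom_of_ker_le π hπ
    (Bialgebra.Quotient.mkBialgHom (R := k) (hopfKer σ.action)) fun a ha =>
      Ideal.Quotient.eq_zero_iff_mem.2 (hker ha)
  refine ⟨φ, hφ, fun y => ?_, fun x hx => ?_⟩
  · obtain ⟨a, rfl⟩ := Ideal.Quotient.mk_surjective y
    exact ⟨π a, hφ a⟩
  · obtain ⟨a, rfl⟩ := hπ x
    rw [hφ] at hx
    rw [hρ]
    exact hopfKer_le_ker σ.action (Ideal.Quotient.eq_zero_iff_mem.1 hx)

/-! ### The corepresentation of the presented Hopf algebra -/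

namespace CuspHopf

variable {k : Type*} [Field k]

theorem KD : gen k .K * gen k .D = -(gen k .D * gen k .K) := by rw [DK, neg_neg]

/-- The entries `E = (1 - K) / 2 - i D`, `F = (1 - K) / 2 - i D K` and
`Z = Y / 6 + (K - 1) / 4 + i (D + D K) / 2`, in this order, of a corepresentation over
`k⟨K, D, Y⟩` with rows `(1, E, Z)`, `(0, K, F)`, `(0, 0, 1)` that acts on the cusp as `σ`.
The last summand of `Z` acts by zero on the cusp, but the coproduct of `Z` needs it. -/
def coaction (i : k) : CuspHopf k × CuspHopf k × CuspHopf k :=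
  ((1 / 2 : k) • (1 - gen k .K) - i • gen k .D,
    (1 / 2 : k) • (1 - gen k .K) - i • (gen k .D * gen k .K),
    (1 / 6 : k) • gen k .Y + (1 / 4 : k) • (gen k .K - 1) +
      (i / 2) • (gen k .D + gen k .D * gen k .K))

/-- The algebra morphism that sends the generating matrix to the upper triangular matrix with
entries `coaction`. -/
def ofFreeHopfAlg (i : k) : FreeHopf k (Fin 3) →ₐ[k] CuspHopf k :=
  FreeHopf.lift (upperSeq (gen k .K) K_sq (coaction i))
    (by
      intro d a b
      have h := congrFun (congrFun (upperSeq_mul (gen k .K) K_sq (coaction i) d).1 a) b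
      rwa [Matrix.mul_apply, Matrix.one_apply] at h)
    (by
      intro d a b
      have h := congrFun (congrFun (upperSeq_mul (gen k .K) K_sq (coaction i) d).2 a) b
      rwa [Matrix.mul_apply, Matrix.one_apply] at h)

theorem ofFreeHopfAlg_gen_zero (i : k) (a b : Fin 3) :
    ofFreeHopfAlg i (FreeHopf.gen k 0 a b) = upperMat (gen k .K) (coaction i) a b := by
  refine (FreeHopf.lift_gen _ _ _ 0 a b).trans ?_
  rw [upperSeq_zero]

theorem ofFreeHopfAlg_gen_one (i : k) (a b : Fin 3) :
    ofFreeHopfAlg i (FreeHopf.gen k 1 a b) = lowerMat (gen k .K) (coaction i) a b := by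
  refine (FreeHopf.lift_gen _ _ _ 1 a b).trans ?_
  simp [upperSeq]

/-- The upper triangular matrix is a corepresentation. The products of `(1 - K) / 2` and `i D` in
`E ⊗ F` are matched by the coproduct of the summand `i (D + D K) / 2` of `Z`. -/
theorem comul_upperMat (h2 : (2 : k) ≠ 0) (h3 : (3 : k) ≠ 0) (i : k) (hi : i * i = -1)
    (a b : Fin 3) :
    Coalgebra.comul (R := k) (upperMat (gen k .K) (coaction i) a b) =
      ∑ r, upperMat (gen k .K) (coaction i) a r ⊗ₜ[k] upperMat (gen k .K) (coaction i) r b := by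
  -- In unknown characteristic the normalization of scalars does not relate `4⁻¹` to `2⁻¹`.
  have h4 : (4 : k)⁻¹ = 2⁻¹ * 2⁻¹ := by rw [← mul_inv]; norm_num
  have h6 : (6 : k)⁻¹ * 6 = 1 := by
    rw [show (6 : k) = 2 * 3 by norm_num]
    exact inv_mul_cancel₀ (mul_ne_zero h2 h3)
  fin_cases a <;> fin_cases b <;>
    simp [Fin.sum_univ_three, upperMat, coaction, comul_gen, comulGen,
      Algebra.TensorProduct.one_def, TensorProduct.tmul_add, TensorProduct.add_tmul, TensorProduct.tmul_sub,
      TensorProduct.sub_tmul, add_mul, K_sq, -TensorProduct.tmul_smul,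
      smul_sub, smul_add, TensorProduct.smul_tmul]
  all_goals simp only [TensorProduct.tmul_smul, smul_smul, h4, h6, hi]
  all_goals module

theorem counit_upperMat (i : k) (a b : Fin 3) :
    Coalgebra.counit (R := k) (upperMat (gen k .K) (coaction i) a b) =
      if a = b then 1 else 0 := by
  fin_cases a <;> fin_cases b <;> simp [upperMat, coaction, counit_gen, counitGen]

theorem antiLinear_upperMat (i : k) (a b : Fin 3) :
    antiLinear (antipodeHom k) (upperMat (gen k .K) (coaction i) a b) =
      lowerMat (gen k .K) (coaction i) b a := by
  -- In unknown characteristic the normalization of scalars does not relate `4⁻¹` to `2⁻¹`.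
  have h4 : (4 : k)⁻¹ = 2⁻¹ * 2⁻¹ := by rw [← mul_inv]; norm_num
  have hDK (x : CuspHopf k) : gen k .K * (gen k .D * x) = -(gen k .D * (gen k .K * x)) := by
    rw [← mul_assoc, KD, neg_mul, mul_assoc]
  fin_cases a <;> fin_cases b <;>
    simp [upperMat, lowerMat, coaction, antiLinear_gen, antipodeGen, antiLinear_one,
      antiLinear_mul, sub_mul, mul_sub, mul_assoc, K_sq, hDK, D_sq, smul_sub, smul_add, smul_smul]
  all_goals try simp only [h4]
  all_goals module

/-- The bialgebra morphism through which the action of the free Hopf algebra on the cusp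
factors. -/
def ofFreeHopf (h2 : (2 : k) ≠ 0) (h3 : (3 : k) ≠ 0) (i : k) (hi : i * i = -1) :
    FreeHopf k (Fin 3) →ₐc[k] CuspHopf k :=
  BialgHom.ofAlgHom (ofFreeHopfAlg i)
    (FreeHopf.hom_ext_zero fun a b => by
      change Coalgebra.counit (R := k) (ofFreeHopfAlg i (FreeHopf.gen k 0 a b)) =
        Coalgebra.counit (R := k) (FreeHopf.gen k 0 a b)
      rw [ofFreeHopfAlg_gen_zero, counit_upperMat, FreeHopf.counit_gen])
    (FreeHopf.hom_ext_zero fun a b => by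
      change Algebra.TensorProduct.map (ofFreeHopfAlg i) (ofFreeHopfAlg i)
        (Coalgebra.comul (R := k) (FreeHopf.gen k 0 a b)) =
          Coalgebra.comul (R := k) (ofFreeHopfAlg i (FreeHopf.gen k 0 a b))
      rw [ofFreeHopfAlg_gen_zero, comul_upperMat h2 h3 i hi, FreeHopf.comul_gen]
      simp only [map_sum, Algebra.TensorProduct.map_tmul, ofFreeHopfAlg_gen_zero])

theorem gen_D_eq (h2 : (2 : k) ≠ 0) (i : k) (hi : i * i = -1) :
    gen k .D = i • ((1 / 2 : k) • ((coaction i).1 - gen k .K * (coaction i).1 * gen k .K)) := by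
  have h : gen k .K * gen k .D * gen k .K = -gen k .D := by
    rw [mul_assoc, DK, mul_neg, ← mul_assoc, K_sq, one_mul]
  simp [coaction, mul_sub, sub_mul, h, K_sq]
  match_scalars
  all_goals field_simp
  · linear_combination 2 * hi
  all_goals ring

theorem gen_Y_eq (h2 : (2 : k) ≠ 0) (h3 : (3 : k) ≠ 0) (i : k) :
    gen k .Y = (6 : k) • ((1 / 2 : k) • ((coaction i).2.2 +
      gen k .K * (coaction i).2.2 * gen k .K)) - (3 / 2 : k) • (gen k .K - 1) := by
  have h : gen k .K * gen k .D * gen k .K = -gen k .D := by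
    rw [mul_assoc, DK, mul_neg, ← mul_assoc, K_sq, one_mul]
  have h' : gen k .K * (gen k .D * gen k .K) * gen k .K = -(gen k .D * gen k .K) := by
    rw [mul_assoc, mul_assoc (gen k .D), K_sq, mul_one, KD]
  have hY : gen k .K * gen k .Y * gen k .K = gen k .Y := by
    rw [mul_assoc, YK, ← mul_assoc, K_sq, one_mul]
  have h6 : (6 : k) ≠ 0 := by
    rw [show (6 : k) = 2 * 3 by norm_num]
    exact mul_ne_zero h2 h3
  have h4 : (4 : k) ≠ 0 := by
    rw [show (4 : k) = 2 * 2 by norm_num]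
    exact mul_ne_zero h2 h2
  simp [coaction, mul_sub, sub_mul, mul_add, add_mul, h, h', hY, K_sq]
  match_scalars
  all_goals field_simp
  all_goals ring

variable (h2 : (2 : k) ≠ 0) (h3 : (3 : k) ≠ 0) (i : k) (hi : i * i = -1)

theorem ofFreeHopf_gen_zero (a b : Fin 3) :
    ofFreeHopf h2 h3 i hi (FreeHopf.gen k 0 a b) = upperMat (gen k .K) (coaction i) a b :=
  ofFreeHopfAlg_gen_zero i a b

/-- The antipode moves the generating matrix in degree `0` to the transposed one in degree `1`, so
the claim reduces to the value of the antipode on the entries of the upper triangular matrix. -/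
theorem antipode_ofFreeHopf (x : FreeHopf k (Fin 3)) :
    HopfAlgebra.antipode k (ofFreeHopf h2 h3 i hi x) =
      ofFreeHopf h2 h3 i hi (HopfAlgebra.antipode k x) := by
  have h : (antipodeHom k).comp (ofFreeHopfAlg i) =
      (AlgHom.op (ofFreeHopfAlg i)).comp (FreeHopf.antipodeHom k (Fin 3)) :=
    FreeHopf.hom_ext_zero fun a b => by
      apply MulOpposite.unop_injective
      change antiLinear (antipodeHom k) (ofFreeHopfAlg i (FreeHopf.gen k 0 a b)) =
        ofFreeHopfAlg i (antiLinear (FreeHopf.antipodeHom k (Fin 3)) (FreeHopf.gen k 0 a b))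
      rw [ofFreeHopfAlg_gen_zero, antiLinear_upperMat, FreeHopf.antiLinear_gen, zero_add,
        ofFreeHopfAlg_gen_one]
  exact congrArg MulOpposite.unop (AlgHom.congr_fun h x)

theorem ofFreeHopf_surjective : Function.Surjective (ofFreeHopf h2 h3 i hi) := by
  let f : FreeHopf k (Fin 3) →ₐ[k] CuspHopf k := ofFreeHopf h2 h3 i hi
  suffices h : f.range = ⊤ from (AlgHom.range_eq_top f).1 h
  have hg (a b : Fin 3) : upperMat (gen k .K) (coaction i) a b ∈ f.range :=
    ⟨FreeHopf.gen k 0 a b, ofFreeHopf_gen_zero h2 h3 i hi a b⟩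
  have hK : gen k .K ∈ f.range := hg 1 1
  have hE : (coaction i).1 ∈ f.range := hg 0 1
  have hZ : (coaction i).2.2 ∈ f.range := hg 0 2
  rw [eq_top_iff, ← PresAlg.adjoin_of k (cuspRel k), Algebra.adjoin_le_iff]
  rintro _ ⟨_ | _ | _, rfl⟩
  · exact hK
  · change gen k .D ∈ f.range
    rw [gen_D_eq h2 i hi]
    exact Subalgebra.smul_mem _ (Subalgebra.smul_mem _
      (sub_mem hE (mul_mem (mul_mem hK hE) hK)) _) _
  · change gen k .Y ∈ f.range
    rw [gen_Y_eq h2 h3 i]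
    exact sub_mem (Subalgebra.smul_mem _ (Subalgebra.smul_mem _
      (add_mem hZ (mul_mem (mul_mem hK hZ) hK)) _) _)
      (Subalgebra.smul_mem _ (sub_mem hK (one_mem _)) _)

end CuspHopf

namespace CuspHopf

variable {k Q : Type*} [CommRing k] [Ring Q] [Bialgebra k Q] (φ : CuspHopf k →ₐc[k] Q)

theorem comul_map_K : Coalgebra.comul (R := k) (φ (gen k .K)) =
    φ (gen k .K) ⊗ₜ[k] φ (gen k .K) := by
  rw [← CoalgHomClass.map_comp_comul_apply, comul_gen]
  rfl

theorem comul_map_D : Coalgebra.comul (R := k) (φ (gen k .D)) =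
    1 ⊗ₜ[k] φ (gen k .D) + φ (gen k .D) ⊗ₜ[k] φ (gen k .K) := by
  rw [← CoalgHomClass.map_comp_comul_apply, comul_gen]
  simp [comulGen]

theorem comul_map_Y : Coalgebra.comul (R := k) (φ (gen k .Y)) =
    1 ⊗ₜ[k] φ (gen k .Y) - (6 : k) • (φ (gen k .D) ⊗ₜ[k] (φ (gen k .D) * φ (gen k .K))) +
      φ (gen k .Y) ⊗ₜ[k] 1 := by
  rw [← CoalgHomClass.map_comp_comul_apply, comul_gen]
  simp [comulGen]

end CuspHopf

/-! ### The action on the ring of the cusp -/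

section CuspAction

variable {k : Type*} [Field k]

/-- The ring of the cusp is spanned by `x ^ n` and `y * x ^ n`, where `x = t²` and `y = t³`. -/
theorem cusp_span : Submodule.span k
    (Set.range (fun n : ℕ => cuspx k ^ n) ∪ Set.range (fun n : ℕ => cuspy k * cuspx k ^ n)) =
      ⊤ := by
  set W := Submodule.span k
    (Set.range (fun n : ℕ => cuspx k ^ n) ∪ Set.range (fun n : ℕ => cuspy k * cuspx k ^ n))
  have h : Subalgebra.toSubmodule (cuspRing k) ≤
      W.map (cuspRing k).val.toLinearMap := by
    rw [Algebra.adjoin_eq_span, Submodule.span_le]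
    intro m hm
    suffices ∃ n : ℕ, m = (cuspx k ^ n : cuspRing k) ∨
        m = (cuspy k * cuspx k ^ n : cuspRing k) by
      obtain ⟨n, rfl | rfl⟩ := this
      · exact ⟨_, Submodule.subset_span (Or.inl ⟨n, rfl⟩), rfl⟩
      · exact ⟨_, Submodule.subset_span (Or.inr ⟨n, rfl⟩), rfl⟩
    induction hm using Submonoid.closure_induction_right with
    | one => exact ⟨0, Or.inl (by simp)⟩
    | mul_right a _ b hb ih =>
      obtain ⟨n, rfl | rfl⟩ := ih <;> obtain rfl | rfl := hb
      · exact ⟨n + 1, Or.inl rfl⟩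
      · exact ⟨n, Or.inr (mul_comm _ _)⟩
      · exact ⟨n + 1, Or.inr (by simp [pow_succ, mul_assoc, cuspx])⟩
      · refine ⟨n + 3, Or.inl ?_⟩
        simp only [cuspx, cuspy, MulMemClass.coe_mul, SubmonoidClass.coe_pow]
        ring
  rw [eq_top_iff]
  rintro b -
  obtain ⟨w, hw, e⟩ := h b.2
  rwa [← Subtype.ext (a1 := w) (a2 := b) e]

theorem cusp_linearMap_ext {M : Type*} [AddCommMonoid M] [Module k M] {f g : cuspRing k →ₗ[k] M}
    (h₁ : ∀ n : ℕ, f (cuspx k ^ n) = g (cuspx k ^ n))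
    (h₂ : ∀ n : ℕ, f (cuspy k * cuspx k ^ n) = g (cuspy k * cuspx k ^ n)) : f = g := by
  apply LinearMap.ext_on cusp_span
  rintro _ (⟨n, rfl⟩ | ⟨n, rfl⟩)
  exacts [h₁ n, h₂ n]

variable (h2 : (2 : k) ≠ 0) (h3 : (3 : k) ≠ 0) (i : k) (hi : i * i = -1)

theorem cuspHom_x : cuspHom h2 h3 i hi (cuspx k) =
    !![cuspx k, 0, algebraMap k _ (1 / 3); 0, cuspx k, 0; 0, 0, cuspx k] := by
  apply cuspIncl_injective
  rw [cuspIncl_cuspHom, ← (cuspT_pow h2 h3 i hi).1]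
  simp [cuspx]

theorem cuspHom_y : cuspHom h2 h3 i hi (cuspy k) =
    !![cuspy k, cuspy k - i • cuspx k, -((1 / 2 : k) • cuspy k);
       0, -cuspy k, cuspy k + i • cuspx k; 0, 0, cuspy k] := by
  apply cuspIncl_injective
  rw [cuspIncl_cuspHom, ← (cuspT_pow h2 h3 i hi).2]
  simp [cuspy]

theorem cuspHom_x_pow (n : ℕ) : cuspHom h2 h3 i hi (cuspx k ^ n) =
    !![cuspx k ^ n, 0, ((n : k) / 3) • cuspx k ^ (n - 1);
       0, cuspx k ^ n, 0; 0, 0, cuspx k ^ n] := by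
  induction n with
  | zero =>
    ext1 a b
    fin_cases a <;> fin_cases b <;> simp
  | succ n ih =>
    rw [pow_succ, map_mul, ih, cuspHom_x]
    ext1 a b
    rcases n with _ | n <;> fin_cases a <;> fin_cases b <;>
      simp [Matrix.mul_apply, Fin.sum_univ_three, Algebra.algebraMap_eq_smul_one, pow_succ]
    module

theorem cuspEntry_x_pow (n : ℕ) :
    cuspEntry h2 h3 i hi 0 1 (cuspx k ^ n) = 0 ∧
    cuspEntry h2 h3 i hi 1 2 (cuspx k ^ n) = 0 ∧
    cuspEntry h2 h3 i hi 1 1 (cuspx k ^ n) = cuspx k ^ n ∧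
    cuspEntry h2 h3 i hi 0 2 (cuspx k ^ n) = ((n : k) / 3) • cuspx k ^ (n - 1) := by
  simp [cuspEntry_apply, cuspHom_x_pow]

/-- The product of `σ(y)` and `σ(x ^ n)`, with `u` for `x ^ n` and `d • v` for the corner entry of
`σ(x ^ n)`. -/
theorem upperTriangular_mul {R : Type*} [CommRing R] [Algebra k R] (c d : k) (x y u v : R) :
    !![y, y - i • x, -(c • y); 0, -y, y + i • x; 0, 0, y] *
        !![u, 0, d • v; 0, u, 0; 0, 0, u] =
      !![y * u, y * u - i • (x * u), d • (y * v) - c • (y * u);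
        0, -(y * u), y * u + i • (x * u); 0, 0, y * u] := by
  ext1 a b
  fin_cases a <;> fin_cases b <;>
    simp [Matrix.mul_apply, Fin.sum_univ_three, add_mul, sub_eq_add_neg]

theorem cuspEntry_y_mul (n : ℕ) :
    cuspEntry h2 h3 i hi 0 1 (cuspy k * cuspx k ^ n) =
      cuspy k * cuspx k ^ n - i • cuspx k ^ (n + 1) ∧
    cuspEntry h2 h3 i hi 1 2 (cuspy k * cuspx k ^ n) =
      cuspy k * cuspx k ^ n + i • cuspx k ^ (n + 1) ∧
    cuspEntry h2 h3 i hi 1 1 (cuspy k * cuspx k ^ n) = -(cuspy k * cuspx k ^ n) ∧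
    cuspEntry h2 h3 i hi 0 2 (cuspy k * cuspx k ^ n) =
      ((n : k) / 3) • (cuspy k * cuspx k ^ (n - 1)) - (1 / 2 : k) • (cuspy k * cuspx k ^ n) := by
  simp only [cuspEntry_apply]
  rw [map_mul, cuspHom_x_pow, cuspHom_y, upperTriangular_mul, pow_succ']
  exact ⟨rfl, rfl, rfl, rfl⟩

/-- The action of `D` on the ring of the cusp: `f ↦ (f(t) - f(-t)) / 2t`. -/
def cuspD : Module.End k (cuspRing k) :=
  i • ((1 / 2 : k) • (cuspEntry h2 h3 i hi 0 1 -
    cuspEntry h2 h3 i hi 1 1 * cuspEntry h2 h3 i hi 0 1 * cuspEntry h2 h3 i hi 1 1))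

/-- The action of `Y` on the ring of the cusp. On the basis `t ^ (2 * n)`, `t ^ (2 * n + 3)` it
is `2 d/dx`, where `x = t²` and `t³` counts as a constant. -/
def cuspY : Module.End k (cuspRing k) :=
  (6 : k) • ((1 / 2 : k) • (cuspEntry h2 h3 i hi 0 2 +
    cuspEntry h2 h3 i hi 1 1 * cuspEntry h2 h3 i hi 0 2 * cuspEntry h2 h3 i hi 1 1)) -
    (3 / 2 : k) • (cuspEntry h2 h3 i hi 1 1 - 1)

theorem cuspD_x_pow (n : ℕ) : cuspD h2 h3 i hi (cuspx k ^ n) = 0 := by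
  simp [cuspD, cuspEntry_x_pow]

theorem cuspD_y_mul (n : ℕ) :
    cuspD h2 h3 i hi (cuspy k * cuspx k ^ n) = cuspx k ^ (n + 1) := by
  simp [cuspD, cuspEntry_x_pow, cuspEntry_y_mul]
  match_scalars
  · ring
  · field_simp
    linear_combination -2 * hi

theorem cuspY_x_pow (n : ℕ) :
    cuspY h2 h3 i hi (cuspx k ^ n) = (2 * n : k) • cuspx k ^ (n - 1) := by
  simp [cuspY, cuspEntry_x_pow]
  match_scalars
  field_simp
  ring

theorem cuspY_y_mul (n : ℕ) :
    cuspY h2 h3 i hi (cuspy k * cuspx k ^ n) = (2 * n : k) • (cuspy k * cuspx k ^ (n - 1)) := by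
  simp [cuspY, cuspEntry_y_mul]
  match_scalars
  · field_simp
    ring
  · field_simp
    ring

theorem cuspC_x_pow (n : ℕ) :
    (cuspY h2 h3 i hi * cuspD h2 h3 i hi - cuspD h2 h3 i hi * cuspY h2 h3 i hi) (cuspx k ^ n) =
      0 := by
  simp [cuspD_x_pow, cuspY_x_pow]

theorem cuspC_y_mul (n : ℕ) :
    (cuspY h2 h3 i hi * cuspD h2 h3 i hi - cuspD h2 h3 i hi * cuspY h2 h3 i hi)
      (cuspy k * cuspx k ^ n) = (2 : k) • cuspx k ^ n := by
  rw [LinearMap.sub_apply, Module.End.mul_apply, Module.End.mul_apply, cuspD_y_mul, cuspY_x_pow,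
    cuspY_y_mul, map_smul, cuspD_y_mul]
  rcases n with _ | n
  · simp
  · simp only [Nat.add_sub_cancel, Nat.cast_add, Nat.cast_one]
    module

/-- The action of `k⟨K, D, Y⟩` on the ring of the cusp. -/
def cuspRep : CuspHopf k →ₐ[k] Module.End k (cuspRing k) :=
  CuspHopf.lift
    (fun
      | .K => cuspEntry h2 h3 i hi 1 1
      | .D => cuspD h2 h3 i hi
      | .Y => cuspY h2 h3 i hi)
    (by
      apply cusp_linearMap_ext <;> intro n <;> simp [pow_two, cuspEntry_x_pow, cuspEntry_y_mul])
    (by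
      apply cusp_linearMap_ext <;> intro n <;>
        simp [cuspEntry_x_pow, cuspEntry_y_mul, cuspD_x_pow, cuspD_y_mul])
    (by
      apply cusp_linearMap_ext <;> intro n <;>
        simp [cuspEntry_x_pow, cuspEntry_y_mul, cuspY_x_pow, cuspY_y_mul])
    (by
      -- The commutator `Y D - D Y` sends `y * x ^ n` to `2 x ^ n` and so commutes with `Y`.
      rw [two_smul]
      refine CuspHopf.serre_of_commute rfl (cusp_linearMap_ext (fun n => ?_) fun n => ?_)
      · rw [Module.End.mul_apply, Module.End.mul_apply, cuspC_x_pow, cuspY_x_pow, map_smul,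
          cuspC_x_pow, map_zero, smul_zero]
      · rw [Module.End.mul_apply, Module.End.mul_apply, cuspC_y_mul, cuspY_y_mul, map_smul,
          map_smul, cuspC_y_mul, cuspY_x_pow, smul_comm])
    (by
      apply cusp_linearMap_ext <;> intro n <;> simp [pow_two, cuspD_x_pow, cuspD_y_mul])

theorem cuspRep_K : cuspRep h2 h3 i hi (CuspHopf.gen k .K) = cuspEntry h2 h3 i hi 1 1 :=
  CuspHopf.lift_gen ..

theorem cuspRep_D : cuspRep h2 h3 i hi (CuspHopf.gen k .D) = cuspD h2 h3 i hi :=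
  CuspHopf.lift_gen ..

theorem cuspRep_Y : cuspRep h2 h3 i hi (CuspHopf.gen k .Y) = cuspY h2 h3 i hi :=
  CuspHopf.lift_gen ..

/-- The action of the free Hopf algebra factors through `k⟨K, D, Y⟩`. -/
theorem cuspRep_comp_ofFreeHopf :
    (cuspRep h2 h3 i hi).comp (CuspHopf.ofFreeHopfAlg i) =
      (cuspAut h2 h3 i hi).action := by
  refine FreeHopf.hom_ext_zero (P := Module.End k (cuspRing k)) (n := Fin 3) ?_
  intro a b
  have h : (cuspAut h2 h3 i hi).action (FreeHopf.gen k 0 a b) = cuspEntry h2 h3 i hi a b := by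
    refine (FreeHopf.lift_gen _ _ _ 0 a b).trans ?_
    ext1 x
    exact cuspAut_seq_zero h2 h3 i hi a b x
  rw [h, AlgHom.comp_apply, CuspHopf.ofFreeHopfAlg_gen_zero]
  have h4 : (4 : k) ≠ 0 := by
    rw [show (4 : k) = 2 * 2 by norm_num]
    exact mul_ne_zero h2 h2
  have h6 : (6 : k) ≠ 0 := by
    rw [show (6 : k) = 2 * 3 by norm_num]
    exact mul_ne_zero h2 h3
  obtain ⟨e1, e2, e3, e4, e5⟩ := cuspEntry_lower h2 h3 i hi
  fin_cases a <;> fin_cases b <;>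
    simp [upperMat, CuspHopf.coaction, cuspRep_K, cuspRep_D, cuspRep_Y, e1, e2, e3, e4, e5]
  all_goals
    apply cusp_linearMap_ext <;> intro n <;>
      simp [cuspEntry_x_pow, cuspEntry_y_mul, cuspD_x_pow, cuspD_y_mul, cuspY_x_pow, cuspY_y_mul]
  all_goals match_scalars
  all_goals field_simp
  all_goals ring

end CuspAction

/-! ### Matrix coefficients acting on a bialgebra -/

section ComulMatrix

variable {k H Q n : Type*} [CommRing k] [Ring H] [Bialgebra k H] [Ring Q] [Bialgebra k Q]
  [Fintype n] [DecidableEq n]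

/-- Hitting the first tensor factor of the coproduct by a matrix representation `r`, that is,
the algebra morphism `x ↦ ∑ r(x₁) ⊗ x₂` with values in matrices over the bialgebra. -/
def comulMatrix (r : H →ₐ[k] Matrix n n k) : H →ₐ[k] Matrix n n H :=
  (Algebra.TensorProduct.lift ((Algebra.ofId k H).mapMatrix.comp r) (Matrix.scalarAlgHom n k)
    (fun _ _ => by
      ext a b
      simpa [Algebra.ofId_apply] using Algebra.commutes _ _)).comp (Bialgebra.comulAlgHom k H)

theorem comulMatrix_apply (r : H →ₐ[k] Matrix n n k) (x : H) (a b : n) :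
    comulMatrix r x a b = TensorProduct.lid k H
      (((Matrix.entryLinearMap k k a b ∘ₗ r.toLinearMap).rTensor H) (Coalgebra.comul x)) := by
  rw [comulMatrix, AlgHom.comp_apply, Bialgebra.comulAlgHom_apply]
  induction Coalgebra.comul (R := k) x using TensorProduct.induction_on with
  | zero => simp
  | add u v hu hv => simp only [map_add, Matrix.add_apply, hu, hv]
  | tmul u v =>
    refine (congrArg (fun M : Matrix n n H => M a b)
      (Algebra.TensorProduct.lift_tmul _ _ _ u v)).trans ?_
    change ((r u).map (algebraMap k H) * Matrix.scalar n v) a b = _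
    simp [Algebra.smul_def]

/-- If a matrix representation factors through a quotient bialgebra, then the kernel of the
quotient map is stable under hitting by the matrix coefficients. -/
theorem map_comulMatrix_eq_zero (r : H →ₐ[k] Matrix n n k) (φ : H →ₐc[k] Q)
    (hφ : Function.Surjective φ) (hr : ∀ x, φ x = 0 → r x = 0) {x : H} (hx : φ x = 0) (a b : n) :
    φ (comulMatrix r x a b) = 0 := by
  obtain ⟨r', hr'⟩ := exists_algHom_of_ker_le (φ : H →ₐ[k] Q) hφ r hr
  replace hr' : ∀ x, r' (φ x) = r x := hr'
  have h0 := CoalgHomClass.map_comp_comul_apply φ x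
  rw [hx, map_zero] at h0
  have h : ∀ w : H ⊗[k] H, φ (TensorProduct.lid k H
      (((Matrix.entryLinearMap k k a b ∘ₗ r.toLinearMap).rTensor H) w)) =
      TensorProduct.lid k Q (((Matrix.entryLinearMap k k a b ∘ₗ r'.toLinearMap).rTensor Q)
        (TensorProduct.map (φ : H →ₗ[k] Q) (φ : H →ₗ[k] Q) w)) := by
    intro w
    induction w using TensorProduct.induction_on with
    | zero => simp
    | add u v hu hv => simp only [map_add, hu, hv]
    | tmul u v => simp [hr']
  rw [comulMatrix_apply, h]
  refine (congrArg (fun w => TensorProduct.lid k Q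
    (((Matrix.entryLinearMap k k a b ∘ₗ r'.toLinearMap).rTensor Q) w)) h0).trans ?_
  simp

end ComulMatrix

/-! ### The submodule with basis `1`, `t²`, `t³` -/

section CuspMatrix

/-- The restriction of the action on the cusp to the submodule with basis `1`, `t²`, `t³`; the
columns hold the images of the basis elements, see `cuspRep_apply_eq_sum`. -/
def cuspMatrixRep (k : Type*) [CommRing k] : CuspHopf k →ₐ[k] Matrix (Fin 3) (Fin 3) k :=
  CuspHopf.lift
    (fun
      | .K => !![1, 0, 0; 0, 1, 0; 0, 0, -1]
      | .D => !![0, 0, 0; 0, 0, 1; 0, 0, 0]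
      | .Y => !![0, 2, 0; 0, 0, 0; 0, 0, 0])
    (by ext a b; fin_cases a <;> fin_cases b <;> simp [pow_two])
    (by ext a b; fin_cases a <;> fin_cases b <;> simp)
    (by ext a b; fin_cases a <;> fin_cases b <;> simp)
    (by ext a b; fin_cases a <;> fin_cases b <;> simp [pow_two])
    (by ext a b; fin_cases a <;> fin_cases b <;> simp [pow_two])

variable {k : Type*} [Field k] (h2 : (2 : k) ≠ 0) (h3 : (3 : k) ≠ 0) (i : k) (hi : i * i = -1)

theorem cuspMatrixRep_K :
    cuspMatrixRep k (CuspHopf.gen k .K) = !![1, 0, 0; 0, 1, 0; 0, 0, -1] :=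
  CuspHopf.lift_gen ..

theorem cuspMatrixRep_D :
    cuspMatrixRep k (CuspHopf.gen k .D) = !![0, 0, 0; 0, 0, 1; 0, 0, 0] :=
  CuspHopf.lift_gen ..

theorem cuspMatrixRep_Y :
    cuspMatrixRep k (CuspHopf.gen k .Y) = !![0, 2, 0; 0, 0, 0; 0, 0, 0] :=
  CuspHopf.lift_gen ..

theorem cuspRep_apply_eq_sum (z : CuspHopf k) (b : Fin 3) :
    cuspRep h2 h3 i hi z (![1, cuspx k, cuspy k] b) =
      ∑ a, cuspMatrixRep k z a b • ![1, cuspx k, cuspy k] a := by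
  have hz : z ∈ Algebra.adjoin k (Set.range (PresAlg.of k (cuspRel k))) := by
    rw [PresAlg.adjoin_of]
    exact Algebra.mem_top
  induction hz using Algebra.adjoin_induction generalizing b with
  | mem z hz =>
    have x0 := cuspEntry_x_pow h2 h3 i hi 0
    have x1 := cuspEntry_x_pow h2 h3 i hi 1
    have y0 := cuspEntry_y_mul h2 h3 i hi 0
    have d0 := cuspD_x_pow h2 h3 i hi 0
    have d1 := cuspD_x_pow h2 h3 i hi 1
    have d2 := cuspD_y_mul h2 h3 i hi 0
    have z0 := cuspY_x_pow h2 h3 i hi 0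
    have z1 := cuspY_x_pow h2 h3 i hi 1
    have z2 := cuspY_y_mul h2 h3 i hi 0
    simp only [pow_zero, pow_one, mul_one, zero_add, Nat.cast_zero, mul_zero, zero_smul,
      Nat.cast_one, Nat.sub_self] at x0 x1 y0 d0 d1 d2 z0 z1 z2
    obtain ⟨_ | _ | _, rfl⟩ := hz
    · change cuspRep h2 h3 i hi (CuspHopf.gen k .K) _ =
        ∑ a, cuspMatrixRep k (CuspHopf.gen k .K) a b • _
      rw [cuspRep_K, cuspMatrixRep_K]
      fin_cases b <;> simp [Fin.sum_univ_three, x0, x1, y0]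
    · change cuspRep h2 h3 i hi (CuspHopf.gen k .D) _ =
        ∑ a, cuspMatrixRep k (CuspHopf.gen k .D) a b • _
      rw [cuspRep_D, cuspMatrixRep_D]
      fin_cases b <;> simp [Fin.sum_univ_three, d0, d1, d2]
    · change cuspRep h2 h3 i hi (CuspHopf.gen k .Y) _ =
        ∑ a, cuspMatrixRep k (CuspHopf.gen k .Y) a b • _
      rw [cuspRep_Y, cuspMatrixRep_Y]
      fin_cases b <;> simp [Fin.sum_univ_three, z0, z1, z2]
  | algebraMap c =>
    simp [Algebra.algebraMap_eq_smul_one, Matrix.one_apply]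
  | add u v _ _ hu hv => simp [hu, hv, add_smul, Finset.sum_add_distrib]
  | mul u v _ _ hu hv =>
    simp only [map_mul, Module.End.mul_apply, hv, map_sum, map_smul, hu, Matrix.mul_apply,
      Finset.sum_smul, Finset.smul_sum, smul_smul]
    rw [Finset.sum_comm]
    simp only [mul_comm]

theorem cuspMatrixRep_eq_zero {z : CuspHopf k} (hz : cuspRep h2 h3 i hi z = 0) :
    cuspMatrixRep k z = 0 := by
  ext a b
  have h := cuspRep_apply_eq_sum h2 h3 i hi z b
  rw [hz, LinearMap.zero_apply, Fin.sum_univ_three] at h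
  replace h := congrArg (fun w : cuspRing k => (w : k[X])) h
  simp [cuspx, cuspy] at h
  have h0 := congrArg (fun w => Polynomial.coeff w 0) h
  have h1 := congrArg (fun w => Polynomial.coeff w 2) h
  have h2 := congrArg (fun w => Polynomial.coeff w 3) h
  simp [Polynomial.coeff_X_pow, Polynomial.coeff_one] at h0 h1 h2
  fin_cases a
  exacts [h0.symm, h1.symm, h2.symm]

end CuspMatrix

/-! ### Normal forms in the presented Hopf algebra -/

namespace CuspHopf

section NormalForm

variable {k : Type*} [Field k]

/-- The commutator of `Y` with `C D + D C = 0` is `2 C ^ 2`. -/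
theorem C_sq (h2 : (2 : k) ≠ 0) : C * C = (0 : CuspHopf k) := by
  have h : (2 : k) • (C * C : CuspHopf k) = 0 := by
    have e : (C : CuspHopf k) = gen k .Y * gen k .D - gen k .D * gen k .Y := rfl
    have a : C * C = gen k .Y * (C * gen k .D) - C * gen k .D * gen k .Y := by
      nth_rewrite 2 [e]
      rw [mul_sub, ← mul_assoc, ← mul_assoc, ← YC, mul_assoc, mul_assoc]
    have b : C * C = gen k .Y * (gen k .D * C) - gen k .D * C * gen k .Y := by
      nth_rewrite 1 [e]
      rw [sub_mul, mul_assoc, mul_assoc, YC, ← mul_assoc (gen k .D)]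
    rw [two_smul]
    nth_rewrite 1 [a]
    rw [b, CD]
    noncomm_ring
  exact (smul_eq_zero.1 h).resolve_left h2

/-- The value `p(Y)` of a polynomial `p`. -/
def polyY (p : k[X]) : CuspHopf k := Polynomial.aeval (gen k .Y) p

theorem Y_mul_polyY (p : k[X]) : gen k .Y * polyY p = polyY (Polynomial.X * p) := by
  simp [polyY]

/-- The combination `p + D q + C r + D C s` with coefficients polynomials in `Y`. -/
def normalForm (p q r s : k[X]) : CuspHopf k :=
  polyY p + gen k .D * polyY q + C * polyY r + gen k .D * C * polyY s

theorem D_mul_normalForm (p q r s : k[X]) :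
    gen k .D * normalForm p q r s = normalForm 0 p 0 r := by
  have h (x : CuspHopf k) : gen k .D * (gen k .D * x) = 0 := by
    rw [← mul_assoc, D_sq, zero_mul]
  simp [normalForm, mul_add, mul_assoc, h, polyY]

theorem C_mul_normalForm (h2 : (2 : k) ≠ 0) (p q r s : k[X]) :
    C * normalForm p q r s = normalForm 0 0 p (-q) := by
  have h (x : CuspHopf k) : C * (gen k .D * x) = -(gen k .D * (C * x)) := by
    rw [← mul_assoc, CD, neg_mul, mul_assoc]
  have h' (x : CuspHopf k) : C * (C * x) = 0 := by
    rw [← mul_assoc, C_sq h2, zero_mul]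
  simp [normalForm, mul_add, mul_assoc, h, h', polyY]

theorem Y_mul_normalForm (h2 : (2 : k) ≠ 0) (p q r s : k[X]) :
    gen k .Y * normalForm p q r s =
      normalForm (Polynomial.X * p) (Polynomial.X * q) (q + Polynomial.X * r)
        (Polynomial.X * s) := by
  have h (x : CuspHopf k) : gen k .Y * (gen k .D * x) = gen k .D * (gen k .Y * x) + C * x := by
    rw [← mul_assoc, YD, add_mul, mul_assoc]
  have h' (x : CuspHopf k) : gen k .Y * (C * x) = C * (gen k .Y * x) := by
    rw [← mul_assoc, YC, mul_assoc]
  have h'' (x : CuspHopf k) : C * (C * x) = 0 := by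
    rw [← mul_assoc, C_sq h2, zero_mul]
  simp only [normalForm, mul_add, mul_assoc, h, h', h'', Y_mul_polyY]
  simp only [polyY, map_add, mul_add]
  abel

theorem normalForm_add (p q r s p' q' r' s' : k[X]) :
    normalForm p q r s + normalForm p' q' r' s' =
      normalForm (p + p') (q + q') (r + r') (s + s') := by
  simp only [normalForm, polyY, map_add, mul_add]
  abel

theorem smul_normalForm (c : k) (p q r s : k[X]) :
    c • normalForm p q r s = normalForm (c • p) (c • q) (c • r) (c • s) := by
  simp only [normalForm, polyY, map_smul, mul_smul_comm, smul_add]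

/-- The subspace of elements of the form `x + K y` with `x` and `y` in normal form. -/
def normalForms (k : Type*) [Field k] : Submodule k (CuspHopf k) where
  carrier := {x | ∃ p q r s p' q' r' s' : k[X],
    x = normalForm p q r s + gen k .K * normalForm p' q' r' s'}
  zero_mem' := ⟨0, 0, 0, 0, 0, 0, 0, 0, by simp [normalForm, polyY]⟩
  add_mem' := by
    rintro _ _ ⟨p, q, r, s, p', q', r', s', rfl⟩ ⟨p₁, q₁, r₁, s₁, p₂, q₂, r₂, s₂, rfl⟩
    rw [add_add_add_comm, ← mul_add, normalForm_add, normalForm_add]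
    exact ⟨_, _, _, _, _, _, _, _, rfl⟩
  smul_mem' := by
    rintro c _ ⟨p, q, r, s, p', q', r', s', rfl⟩
    rw [smul_add, ← mul_smul_comm, smul_normalForm, smul_normalForm]
    exact ⟨_, _, _, _, _, _, _, _, rfl⟩

/-- The elements `K^a D^b C^c Y^n` with `a, b, c ≤ 1` span the algebra. -/
theorem normalForms_eq_top (h2 : (2 : k) ≠ 0) : normalForms k = ⊤ := by
  have hK {x : CuspHopf k} (hx : x ∈ normalForms k) : gen k .K * x ∈ normalForms k := by
    obtain ⟨p, q, r, s, p', q', r', s', rfl⟩ := hx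
    refine ⟨p', q', r', s', p, q, r, s, ?_⟩
    rw [mul_add, ← mul_assoc, K_sq, one_mul, add_comm]
  have hn (p q r s : k[X]) : normalForm p q r s ∈ normalForms k :=
    ⟨p, q, r, s, 0, 0, 0, 0, by simp [normalForm, polyY]⟩
  have hD {x : CuspHopf k} (hx : x ∈ normalForms k) : gen k .D * x ∈ normalForms k := by
    obtain ⟨p, q, r, s, p', q', r', s', rfl⟩ := hx
    rw [mul_add, ← mul_assoc, DK, neg_mul, mul_assoc, D_mul_normalForm, D_mul_normalForm]
    exact add_mem (hn ..) (neg_mem (hK (hn ..)))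
  have hY {x : CuspHopf k} (hx : x ∈ normalForms k) : gen k .Y * x ∈ normalForms k := by
    obtain ⟨p, q, r, s, p', q', r', s', rfl⟩ := hx
    rw [mul_add, ← mul_assoc, YK, mul_assoc, Y_mul_normalForm h2, Y_mul_normalForm h2]
    exact add_mem (hn ..) (hK (hn ..))
  have h1 : (1 : CuspHopf k) ∈ normalForms k := by
    have := hn 1 0 0 0
    simpa [normalForm, polyY] using this
  have key (z : CuspHopf k) : ∀ x ∈ normalForms k, z * x ∈ normalForms k := by
    have hz : z ∈ Algebra.adjoin k (Set.range (PresAlg.of k (cuspRel k))) := by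
      rw [PresAlg.adjoin_of]
      exact Algebra.mem_top
    induction hz using Algebra.adjoin_induction with
    | mem z hz =>
      intro x hx
      obtain ⟨_ | _ | _, rfl⟩ := hz
      exacts [hK hx, hD hx, hY hx]
    | algebraMap c =>
      intro x hx
      rw [← Algebra.smul_def]
      exact Submodule.smul_mem _ c hx
    | add u v _ _ hu hv =>
      intro x hx
      rw [add_mul]
      exact add_mem (hu x hx) (hv x hx)
    | mul u v _ _ hu hv =>
      intro x hx
      rw [mul_assoc]
      exact hu _ (hv x hx)
  rw [eq_top_iff]
  rintro z -
  simpa using key z 1 h1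

end NormalForm

/-! ### Injectivity in characteristic zero -/

section Injectivity

variable {k : Type*} [Field k]

theorem comulMatrix_K : comulMatrix (cuspMatrixRep k) (gen k .K) =
    !![gen k .K, 0, 0; 0, gen k .K, 0; 0, 0, -gen k .K] := by
  ext a b
  rw [comulMatrix_apply, comul_gen]
  fin_cases a <;> fin_cases b <;> simp [comulGen, cuspMatrixRep_K]

theorem comulMatrix_D : comulMatrix (cuspMatrixRep k) (gen k .D) =
    !![gen k .D, 0, 0; 0, gen k .D, gen k .K; 0, 0, gen k .D] := by
  ext a b
  rw [comulMatrix_apply, comul_gen]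
  fin_cases a <;> fin_cases b <;> simp [comulGen, cuspMatrixRep_D]

theorem comulMatrix_Y : comulMatrix (cuspMatrixRep k) (gen k .Y) =
    !![gen k .Y, 2, 0; 0, gen k .Y, -((6 : k) • (gen k .D * gen k .K)); 0, 0, gen k .Y] := by
  ext a b
  rw [comulMatrix_apply, comul_gen]
  fin_cases a <;> fin_cases b <;> simp [comulGen, cuspMatrixRep_D, cuspMatrixRep_Y]
  rw [ofNat_smul_eq_nsmul, two_nsmul, one_add_one_eq_two]

theorem comulMatrix_C : comulMatrix (cuspMatrixRep k) C =
    !![C, 0, (2 : k) • gen k .K; 0, C, 0; 0, 0, C] := by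
  have h : gen k .D * gen k .K * gen k .D = 0 := by
    rw [DK, neg_mul, mul_assoc, D_sq, mul_zero, neg_zero]
  have h' : gen k .D * (gen k .D * gen k .K) = 0 := by rw [← mul_assoc, D_sq, zero_mul]
  rw [C, map_sub, map_mul, map_mul, comulMatrix_Y, comulMatrix_D]
  ext a b
  fin_cases a <;> fin_cases b <;> simp [h, h', YK, mul_two, two_smul]

/-- Hitting by the coefficient in row `0`, column `1` is twice the derivative on polynomials
in `Y`. -/
theorem comulMatrix_polyY (p : k[X]) :
    let M := comulMatrix (cuspMatrixRep k) (polyY p)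
    M 1 0 = 0 ∧ M 2 0 = 0 ∧ M 2 1 = 0 ∧ M 0 0 = polyY p ∧ M 1 1 = polyY p ∧ M 2 2 = polyY p ∧
      M 0 1 = (2 : k) • polyY (Polynomial.derivative p) := by
  dsimp only
  induction p using Polynomial.induction_on with
  | C a =>
    simp [polyY, Matrix.algebraMap_matrix_apply]
  | add p q hp hq =>
    simp only [polyY, map_add, Matrix.add_apply] at *
    simp [hp, hq]
  | monomial n a h =>
    rw [pow_succ, ← mul_assoc]
    generalize Polynomial.C a * Polynomial.X ^ n = q at h ⊢
    have e (q : k[X]) : polyY (q * Polynomial.X) = polyY q * gen k .Y := by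
      simp [polyY]
    rw [e, map_mul, comulMatrix_Y, Polynomial.derivative_mul, Polynomial.derivative_X, mul_one]
    simp only [Matrix.mul_apply, Fin.sum_univ_three, h]
    have e' : polyY (Polynomial.derivative q * Polynomial.X + q) =
        polyY (Polynomial.derivative q) * gen k .Y + polyY q := by
      rw [← e]
      simp [polyY]
    simp [e', two_smul, mul_two, add_mul]
    abel

/-- If a kernel that is stable under hitting by the coefficients of `cuspMatrixRep` contained
`D C`, it would contain `1`: hitting by coefficients in column `2` takes `D C` to `2 D K` and `D`
to `K`. -/
theorem map_DC_ne_zero {Q : Type*} [Ring Q] [Algebra k Q] [Nontrivial Q] (h2 : (2 : k) ≠ 0)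
    (φ : CuspHopf k →ₐ[k] Q)
    (hφ : ∀ x, φ x = 0 → ∀ a b, φ (comulMatrix (cuspMatrixRep k) x a b) = 0) :
    φ (gen k .D * C) ≠ 0 := by
  intro h
  have h₁ := hφ _ h 0 2
  rw [map_mul, comulMatrix_D, comulMatrix_C] at h₁
  simp [h2] at h₁
  have hD : φ (gen k .D) = 0 := by
    rw [← mul_one (gen k .D), ← K_sq, ← mul_assoc, map_mul, map_mul, h₁, zero_mul]
  have hK := hφ _ hD 1 2
  rw [comulMatrix_D] at hK
  replace hK : φ (gen k .K) = 0 := hK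
  have h1 : φ 1 = 0 := by rw [← K_sq, map_mul, hK, zero_mul]
  exact one_ne_zero ((map_one φ).symm.trans h1)

variable {Q : Type*} [Ring Q] [Algebra k Q] [Nontrivial Q] [CharZero k]

/-- Differentiating with respect to `Y` reduces the claim to the case of constant `p`. In positive
characteristic this breaks down, as the derivative of a nonconstant polynomial may vanish. -/
theorem eq_zero_of_map_DC_mul_polyY (φ : CuspHopf k →ₐ[k] Q)
    (hφ : ∀ x, φ x = 0 → ∀ a b, φ (comulMatrix (cuspMatrixRep k) x a b) = 0) (p : k[X])
    (hp : φ (gen k .D * C * polyY p) = 0) : p = 0 := by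
  have hc (p : k[X]) (hp : φ (gen k .D * C * polyY p) = 0) (hd : p.natDegree = 0) : p = 0 := by
    rw [Polynomial.eq_C_of_natDegree_eq_zero hd] at hp ⊢
    rw [polyY, Polynomial.aeval_C, ← Algebra.commutes, ← Algebra.smul_def, map_smul] at hp
    rw [(smul_eq_zero.1 hp).resolve_right (map_DC_ne_zero two_ne_zero φ hφ), Polynomial.C_0]
  have key (n : ℕ) : ∀ p : k[X], φ (gen k .D * C * polyY p) = 0 → p.natDegree ≤ n → p = 0 := by
    induction n with
    | zero => exact fun p hp hd => hc p hp (Nat.le_zero.1 hd)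
    | succ n ih =>
      intro p hp hd
      obtain ⟨m10, m20, m21, m00, m11, m22, m01⟩ := comulMatrix_polyY p
      have h := hφ _ hp 0 1
      rw [map_mul, map_mul, comulMatrix_D, comulMatrix_C, Matrix.mul_apply,
        Fin.sum_univ_three, m01, m11, m21] at h
      simp at h
      rw [← map_mul, ← map_mul] at h
      refine hc p hp (Polynomial.derivative_eq_zero.1 (ih _ h ?_))
      exact (Polynomial.natDegree_derivative_le p).trans (by omega)
  exact key _ p hp le_rfl

/-- Multiplication by `D C`, `C` and `D` isolates the coefficients `p`, `q` and `r` in turn. -/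
theorem normalForm_eq_zero_of_map (φ : CuspHopf k →ₐ[k] Q)
    (hφ : ∀ x, φ x = 0 → ∀ a b, φ (comulMatrix (cuspMatrixRep k) x a b) = 0) (p q r s : k[X])
    (h : φ (normalForm p q r s) = 0) : normalForm p q r s = 0 := by
  have h2 : (2 : k) ≠ 0 := two_ne_zero
  have hs (s : k[X]) (h : φ (normalForm 0 0 0 s) = 0) : s = 0 := by
    refine eq_zero_of_map_DC_mul_polyY φ hφ s ?_
    simpa [normalForm, polyY] using h
  have hl (z : CuspHopf k) {x : CuspHopf k} (hx : φ x = 0) : φ (z * x) = 0 := by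
    rw [map_mul, hx, mul_zero]
  obtain rfl : p = 0 := by
    apply hs
    rw [← D_mul_normalForm 0 0 p (-q), ← C_mul_normalForm h2 p q r s]
    exact hl _ (hl _ h)
  obtain rfl : q = 0 := by
    have := hl C h
    rw [C_mul_normalForm h2] at this
    exact neg_eq_zero.1 (hs _ this)
  obtain rfl : r = 0 := by
    have := hl (gen k .D) h
    rw [D_mul_normalForm] at this
    exact hs _ this
  obtain rfl : s = 0 := hs s h
  simp [normalForm, polyY]

/-- Hitting by the coefficient in row and column `2` is the automorphism `K ↦ -K`. It splits an
element `x + K y` of the kernel, with `x` and `y` in normal form, into `x` and `K y`. -/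
theorem injective_of_comulMatrix (φ : CuspHopf k →ₐ[k] Q)
    (hφ : ∀ x, φ x = 0 → ∀ a b, φ (comulMatrix (cuspMatrixRep k) x a b) = 0) :
    Function.Injective φ := by
  rw [injective_iff_map_eq_zero]
  intro x hx
  have h2 : (2 : k) ≠ 0 := two_ne_zero
  have hmem : x ∈ normalForms k := by
    rw [normalForms_eq_top h2]
    trivial
  obtain ⟨p, q, r, s, p', q', r', s', rfl⟩ := hmem
  have hn (p q r s : k[X]) :
      comulMatrix (cuspMatrixRep k) (normalForm p q r s) 2 2 = normalForm p q r s := by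
    simp only [normalForm, map_add, map_mul, comulMatrix_D, comulMatrix_C, Matrix.add_apply,
      Matrix.mul_apply, Fin.sum_univ_three, comulMatrix_polyY p, comulMatrix_polyY q,
      comulMatrix_polyY r, comulMatrix_polyY s]
    simp
  have h := hφ _ hx 2 2
  rw [map_add, map_mul, comulMatrix_K, Matrix.add_apply, Matrix.mul_apply, Fin.sum_univ_three,
    hn, hn] at h
  simp only [map_add, map_mul] at hx
  simp at h
  have h₁ : φ (normalForm p q r s) = 0 := by
    have : (2 : k) • φ (normalForm p q r s) = 0 := by
      rw [two_smul]
      nth_rewrite 1 [eq_neg_of_add_eq_zero_left hx]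
      rw [eq_neg_of_add_eq_zero_left h, neg_neg, neg_add_cancel]
    exact (smul_eq_zero.1 this).resolve_left h2
  have h₂ : φ (normalForm p' q' r' s') = 0 := by
    rw [h₁, zero_add] at hx
    rw [← one_mul (normalForm _ _ _ _), ← K_sq, mul_assoc, map_mul, map_mul, hx, mul_zero]
  rw [normalForm_eq_zero_of_map φ hφ _ _ _ _ h₁, normalForm_eq_zero_of_map φ hφ _ _ _ _ h₂,
    mul_zero, add_zero]

end Injectivity

end CuspHopf

end

theorem mainTheorem2 {k : Type*} [Field k] (h2 : (2 : k) ≠ 0) (h3 : (3 : k) ≠ 0)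
    (i : k) (hi : i * i = -1) :
    ∃ φ : CuspHopf k →ₐc[k] (cuspAut h2 h3 i hi).HopfImage,
      φ (CuspHopf.gen k .K) = CuspHopfImage.K h2 h3 i hi ∧
      φ (CuspHopf.gen k .D) = CuspHopfImage.D h2 h3 i hi ∧
      φ (CuspHopf.gen k .Y) = CuspHopfImage.Y h2 h3 i hi ∧
      Coalgebra.comul (R := k) (CuspHopfImage.K h2 h3 i hi) =
        CuspHopfImage.K h2 h3 i hi ⊗ₜ[k] CuspHopfImage.K h2 h3 i hi ∧
      Coalgebra.comul (R := k) (CuspHopfImage.D h2 h3 i hi) =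
        1 ⊗ₜ[k] CuspHopfImage.D h2 h3 i hi +
          CuspHopfImage.D h2 h3 i hi ⊗ₜ[k] CuspHopfImage.K h2 h3 i hi ∧
      Coalgebra.comul (R := k) (CuspHopfImage.Y h2 h3 i hi) =
        1 ⊗ₜ[k] CuspHopfImage.Y h2 h3 i hi -
          (6 : k) • (CuspHopfImage.D h2 h3 i hi ⊗ₜ[k]
            (CuspHopfImage.D h2 h3 i hi * CuspHopfImage.K h2 h3 i hi)) +
          CuspHopfImage.Y h2 h3 i hi ⊗ₜ[k] 1 ∧
      Function.Surjective φ ∧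
      (CharZero k → Function.Bijective φ) := by
  obtain ⟨φ, hφ, hφs, hρφ⟩ := (cuspAut h2 h3 i hi).exists_bialgHom_hopfImage
    (CuspHopf.ofFreeHopf h2 h3 i hi) (CuspHopf.ofFreeHopf_surjective h2 h3 i hi)
    (CuspHopf.antipode_ofFreeHopf h2 h3 i hi) (cuspRep h2 h3 i hi)
    (AlgHom.congr_fun (cuspRep_comp_ofFreeHopf h2 h3 i hi))
  have hgen (a b : Fin 3) :
      φ (upperMat (CuspHopf.gen k .K) (CuspHopf.coaction i) a b) =
        (cuspAut h2 h3 i hi).gen 0 a b := by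
    rw [← CuspHopf.ofFreeHopf_gen_zero h2 h3 i hi a b]
    exact hφ _
  have hK : φ (CuspHopf.gen k .K) = CuspHopfImage.K h2 h3 i hi := hgen 1 1
  have hE : φ (CuspHopf.coaction i).1 = CuspHopfImage.E h2 h3 i hi := hgen 0 1
  have hZ : φ (CuspHopf.coaction i).2.2 = CuspHopfImage.Z h2 h3 i hi := hgen 0 2
  have hD : φ (CuspHopf.gen k .D) = CuspHopfImage.D h2 h3 i hi := by
    rw [CuspHopf.gen_D_eq h2 i hi, CuspHopfImage.D]
    simp only [map_smul, map_sub, map_mul, hE, hK]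
  have hY : φ (CuspHopf.gen k .Y) = CuspHopfImage.Y h2 h3 i hi := by
    rw [CuspHopf.gen_Y_eq h2 h3 i, CuspHopfImage.Y]
    simp only [map_smul, map_sub, map_add, map_mul, map_one, hZ, hK]
  refine ⟨φ, hK, hD, hY, ?_, ?_, ?_, hφs, fun _ => ⟨?_, hφs⟩⟩
  · rw [← hK]
    exact CuspHopf.comul_map_K φ
  · rw [← hD, ← hK]
    exact CuspHopf.comul_map_D φ
  · rw [← hD, ← hK, ← hY]
    exact CuspHopf.comul_map_Y φ
  -- The Hopf image is nonzero since `1` acts on the cusp as the identity.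
  · have : Nontrivial (cuspAut h2 h3 i hi).HopfImage := by
      refine ⟨1, 0, fun h => ?_⟩
      have h := hρφ 1 ((map_one φ).trans h)
      rw [map_one] at h
      exact one_ne_zero (LinearMap.congr_fun h 1)
    refine CuspHopf.injective_of_comulMatrix
      (φ : CuspHopf k →ₐ[k] (cuspAut h2 h3 i hi).HopfImage) fun x hx => ?_
    exact map_comulMatrix_eq_zero (cuspMatrixRep k) φ hφs
        (fun x hx => cuspMatrixRep_eq_zero h2 h3 i hi (hρφ x hx)) hx
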